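/- **Setting.** Let $\dot W=\{\dot W(h),\,h\in\mathcal U\}$ be a zero-mean Gaussian family, indexed by a real separable Hilbert space $\mathcal U$, on a probability space $(\Omega,\mathcal F,\mathbb P)$, with $\mathbb E(\dot W(h_1)\dot W(h_2))=(h_1,h_2)_{\mathcal U}$. Fix an orthonormal basis $\{\mathfrak u_k\}$ of $\mathcal U$ and put $\xi_k=\dot W(\mathfrak u_k)$. Let $\mathcal J$ be the set of multi-indices $\alpha=(\alpha_1,\alpha_2,\dots)$ of non-negative integers with $|\alpha|=\sum_k\alpha_k<\infty$, let $\varepsilon_k\in\mathcal J$ be the $k$-th unit multi-index, and put $\xi_\alpha=\prod_k H_{\alpha_k}(\xi_k)/\sqrt{\alpha_k!}$, where $H_n(x)=(-1)^ne^{x^2/2}\frac{d^n}{dx^n}e^{-x^2/2}$. A weight sequence is $Q=\{q_k\}$ with all $q_k\ge1$; put $q^{r\alpha}=\prod_kq_k^{r\alpha_k}$. For a Hilbert space $X$ and $r\in\mathbb R$, $(\mathcal L)_{Q,r}(X)$ is the space of formal series $\eta=\sum_{\alpha\in\mathcal J}\eta_\alpha\xi_\alpha$, $\eta_\alpha\in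 X$, with $$\|\eta\|_{Q,r;X}^2=\sum_{\alpha\in\mathcal J}\frac{q^{2r\alpha}}{|\alpha|!}\|\eta_\alpha\|_X^2<\infty .$$ A square-integrable random variable $\zeta$ belongs to the dual $(\mathcal L)^{Q,r}$ of $(\mathcal L)_{Q,r}(\mathbb R)$ if the functional $\eta\mapsto\mathbb E(\eta\zeta)$, defined on finite sums $\eta=\sum\eta_\alpha\xi_\alpha$ with $\eta_\alpha\in\mathbb R$, is bounded in the norm $\|\cdot\|_{Q,r;\mathbb R}$. For $\eta\in(\mathcal L)_{Q,r}(X)$ and such a $\zeta$ put $\langle\!\langle\eta,\zeta\rangle\!\rangle=\sum_\alpha\mathbb E(\zeta\xi_\alpha)\,\eta_\alpha\in X$. For $h\in\mathcal U$ let $\mathcal E_h=\exp\big(\dot W(h)-\tfrac12\|h\|_{\mathcal U}^2\big)$ and write $\eta_h=\langle\!\langle\eta,\mathcal E_h\rangle\!\rangle$. Say that $\eta_h$ is defined, for a given weight sequence $Q$, if there is $r\in\mathbb R$ with $\eta\in(\mathcal L)_{Q,r}(X)$ and $\mathcal E_h\in(\mathcal L)^{Q,r}$. Say that $h$ is sufficiently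 small relative to $Q$ if $\sum_kq_k^{2\rho}(h,\mathfrak u_k)_{\mathcal U}^2<1$ for some $\rho>0$. Let $(V,H,V')$ be a normal triple of real Hilbert spaces: $V\hookrightarrow H\hookrightarrow V'$ with dense continuous embeddings, $V'$ being the dual of $V$ (up to equivalence of norms) relative to the inner product of $H$. Let $T>0$ and put $\mathcal V(T)=L_2((0,T);V)$, $\mathcal V'(T)=L_2((0,T);V')$. For every $t$ let $\mathbf A(t):V\to V'$ and $\mathbf M(t):V\to V'\otimes\mathcal U$ (Hilbert tensor product) be bounded linear operators such that $\mathbf Av\in\mathcal V'(T)$ and $\mathbf Mv\in L_2((0,T);V'\otimes\mathcal U)$ for every $v\in\mathcal V(T)$. Put $\mathbf M_k(t)v=(\mathbf M(t)v,\mathfrak u_k)_{\mathcal U}\in V'$. Let $Q$ be a weight sequence, $u^0=\sum_\alpha u^0_\alpha\xi_\alpha\in\bigcup_r(\mathcal L)_{Q,r}(H)$ and $f=\sum_\alpha f_\alpha\xi_\alpha\in\bigcup_r(\mathcal L)_{Q,r}(\mathcal V'(T))$. Let $Q'$ be a weight sequence and $r'\in\mathbb R$. An element $u$ of $(\mathcal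 L)_{Q',r'}(\mathcal V(T))$ is a solution of $$u(t)=u^0+\int_0^t\big(\mathbf A(s)u(s)+f(s)+\boldsymbol\delta(\mathbf M(s)u(s))\big)\,ds,\qquad 0\le t\le T, \tag{1}$$ if for every $h\in\mathcal U$ that is sufficiently small relative to $Q'$, with $\mathcal E_h\in(\mathcal L)^{Q',r'}$, and for which $u^0_h$ and $f_h$ are defined (for $Q$), the equality $$u_h(t)=u^0_h+\int_0^t\big(\mathbf A(s)u_h(s)+f_h(s)+(\mathbf M(s)u_h(s),h)_{\mathcal U}\big)\,ds$$ holds in $\mathcal V'(T)$. **Theorem.** Let $u=\sum_{\alpha\in\mathcal J}u_\alpha\xi_\alpha\in(\mathcal L)_{Q',r'}(\mathcal V(T))$. Then $u$ is a solution of (1) if and only if 1. every $u_\alpha$ is an element of $C([0,T];H)$ (that is, it agrees a.e. on $(0,T)$ with a continuous function $[0,T]\to H$), and 2. for every $\alpha\in\mathcal J$ the equality $$u_\alpha(t)=u^0_\alpha+\int_0^t\Big(\mathbf A(s)u_\alpha(s)+f_\alpha(s)+\sum_{k}\sqrt{\alpha_k}\,\mathbf M_k(s)u_{\alpha-\varepsilon_k}(s)\Big)ds$$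 holds in $\mathcal V'(T)$, where terms with $\alpha_k=0$ are zero. -/

import Mathlib

open MeasureTheory ProbabilityTheory
open scoped TensorProduct InnerProductSpace

/-- A normal triple `V ↪ H ↪ V'` of real Hilbert spaces: both embeddings are injective, continuous
and dense, and `V'` is the dual of `V` through a pairing `⟨v', v⟩` that extends the inner product
of `H` (up to equivalence of norms on `V'`). -/
structure NormalTriple (V H V' : Type*)
    [NormedAddCommGroup V] [InnerProductSpace ℝ V]
    [NormedAddCommGroup H] [InnerProductSpace ℝ H]
    [NormedAddCommGroup V'] [InnerProductSpace ℝ V'] where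
  /-- the embedding `V ↪ H` -/
  embVH : V →L[ℝ] H
  /-- the embedding `H ↪ V'` -/
  embHV' : H →L[ℝ] V'
  injVH : Function.Injective embVH
  injHV' : Function.Injective embHV'
  denseVH : DenseRange embVH
  denseHV' : DenseRange embHV'
  /-- `V'` is the dual of `V` -/
  duality : V' ≃L[ℝ] (V →L[ℝ] ℝ)
  duality_eq_inner : ∀ (f : H) (v : V), duality (embHV' f) v = ⟪f, embVH v⟫_ℝ
  exists_bound : ∃ C : ℝ, 0 < C ∧ ∀ (f : H) (v : V),
    |⟪f, embVH v⟫_ℝ| ≤ C * ‖v‖ * ‖embHV' f‖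

/-- Lebesgue measure on `(0,T)`. -/
noncomputable def timeMeasure (T : ℝ) : Measure ℝ := volume.restrict (Set.Ioo 0 T)

/-- The space `L₂((0,T); X)`. -/
noncomputable abbrev TimeL2 (T : ℝ) (X : Type*) [NormedAddCommGroup X] := Lp X 2 (timeMeasure T)

/-- A zero-mean Gaussian family `W(h)`, `h ∈ U`, with `E (W(h₁) W(h₂)) = (h₁, h₂)`. -/
structure IsGaussianNoise {Ω U : Type*} [MeasurableSpace Ω] [NormedAddCommGroup U]
    [InnerProductSpace ℝ U] (P : Measure Ω) (W : U → Ω → ℝ) : Prop where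
  gaussian : IsGaussianProcess W P
  mean_zero : ∀ h, ∫ ω, W h ω ∂P = 0
  cov : ∀ h₁ h₂, ∫ ω, W h₁ ω * W h₂ ω ∂P = ⟪h₁, h₂⟫_ℝ

/-- Multi-indices with finitely many nonzero entries. -/
abbrev MultiIndex (ι : Type*) := ι →₀ ℕ

section Chaos

variable {ι Ω U : Type*} [MeasurableSpace Ω] [NormedAddCommGroup U] [InnerProductSpace ℝ U]

/-- `ξ_α = ∏ₖ H_{α_k}(ξ_k) / √(α_k!)`, with `ξ_k = W(e_k)` and `Hₙ` the probabilists' Hermite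
polynomials. -/
noncomputable def chaosBasis (W : U → Ω → ℝ) (e : HilbertBasis ι ℝ U) (α : MultiIndex ι) (ω : Ω) :
    ℝ :=
  α.prod fun k n =>
    Polynomial.aeval (W (e k) ω) (Polynomial.hermite n) / √(n.factorial : ℝ)

/-- `exp (W(h) - ‖h‖² / 2)`. -/
noncomputable def stochExp (W : U → Ω → ℝ) (h : U) (ω : Ω) : ℝ :=
  Real.exp (W h ω - ‖h‖ ^ 2 / 2)

/-- A weight sequence: `q_k ≥ 1` for all `k`. -/
def IsWeight (q : ι → ℝ) : Prop := ∀ k, 1 ≤ q k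

/-- `q^{2rα} / |α|!`, the weight of the index `α` in the squared norm of `(L)_{q,r}`. -/
noncomputable def chaosWeight (q : ι → ℝ) (r : ℝ) (α : MultiIndex ι) : ℝ :=
  (α.prod fun k n => q k ^ (2 * r * n)) / (α.degree.factorial : ℝ)

/-- The formal series `∑ η_α ξ_α` with coefficients in `X` belongs to `(L)_{q,r}(X)`. -/
def MemChaos {X : Type*} [NormedAddCommGroup X] (q : ι → ℝ) (r : ℝ) (η : MultiIndex ι → X) : Prop :=
  Summable fun α => chaosWeight q r α * ‖η α‖ ^ 2

/-- The square-integrable random variable `ζ` belongs to the dual `(L)^{q,r}` of the real-valued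
space `(L)_{q,r}` relative to the inner product of `L₂(Ω)`: the functional `η ↦ E (η ζ)`, on
finite sums `η = ∑ η_α ξ_α`, is bounded in the norm of `(L)_{q,r}`. -/
def MemChaosDual (P : Measure Ω) (W : U → Ω → ℝ) (e : HilbertBasis ι ℝ U) (q : ι → ℝ) (r : ℝ)
    (ζ : Ω → ℝ) : Prop :=
  ∃ C : ℝ, ∀ η : MultiIndex ι →₀ ℝ,
    |∫ ω, (η.sum fun α c => c * chaosBasis W e α ω) * ζ ω ∂P| ≤
      C * √(η.sum fun α c => chaosWeight q r α * c ^ 2)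

/-- The duality `⟪⟪η, ζ⟫⟫ = ∑ ζ_α η_α ∈ X`, where `ζ_α = E (ζ ξ_α)`. The series converges
absolutely if `η ∈ (L)_{q,r}(X)` and `ζ ∈ (L)^{q,r}` for some `q` and `r`. -/
noncomputable def chaosPairing {X : Type*} [NormedAddCommGroup X] [NormedSpace ℝ X]
    (P : Measure Ω) (W : U → Ω → ℝ) (e : HilbertBasis ι ℝ U)
    (η : MultiIndex ι → X) (ζ : Ω → ℝ) : X :=
  ∑' α, (∫ ω, ζ ω * chaosBasis W e α ω ∂P) • η α

/-- `h` is sufficiently small relative to `q`: for some `ρ > 0`, `h` is in the domain of `Λ^ρ`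
and `‖Λ^ρ h‖ < 1`, where `Λ e_k = q_k e_k`. -/
def SufficientlySmall (e : HilbertBasis ι ℝ U) (q : ι → ℝ) (h : U) : Prop :=
  ∃ ρ : ℝ, 0 < ρ ∧ Summable (fun k => (q k ^ ρ * ⟪e k, h⟫_ℝ) ^ 2) ∧
    √(∑' k, (q k ^ ρ * ⟪e k, h⟫_ℝ) ^ 2) < 1

end Chaos

/-- The Hilbert space tensor product `X ⊗ U`. -/
abbrev HilbertTensor (X U : Type*) [NormedAddCommGroup X] [InnerProductSpace ℝ X]
    [NormedAddCommGroup U] [InnerProductSpace ℝ U] := UniformSpace.Completion (X ⊗[ℝ] U)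

/-- The partial inner product `z ↦ (z, h)_U` from `X ⊗ U` to `X`, determined by
`(x ⊗ g, h)_U = (g, h) x`; it is the adjoint of `x ↦ x ⊗ h`. -/
noncomputable def innerU {X U : Type*} [NormedAddCommGroup X] [InnerProductSpace ℝ X]
    [CompleteSpace X] [NormedAddCommGroup U] [InnerProductSpace ℝ U] (h : U) :
    HilbertTensor X U →L[ℝ] X :=
  ContinuousLinearMap.adjoint
    ((UniformSpace.Completion.toComplL (𝕜 := ℝ) (E := X ⊗[ℝ] U)).comp
      ((TensorProduct.mkL ℝ X U).flip h))

section Equation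

variable {V H V' U ι Ω : Type*}
  [NormedAddCommGroup V] [InnerProductSpace ℝ V]
  [NormedAddCommGroup H] [InnerProductSpace ℝ H]
  [NormedAddCommGroup V'] [InnerProductSpace ℝ V'] [CompleteSpace V']
  [NormedAddCommGroup U] [InnerProductSpace ℝ U] [MeasurableSpace Ω]

/-- `u` is a solution in `(L)_{q',r'}(L₂((0,T);V))` of
`u(t) = u⁰ + ∫₀ᵗ (A(s)u(s) + f(s) + δ(M(s)u(s))) ds`: for every `h` that is sufficiently small
relative to `q'` and for which the dualities `u_h`, `u⁰_h`, `f_h` of `u`, `u⁰`, `f` with the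
stochastic exponential of `h` are defined, `u_h = u⁰_h + ∫ (A u_h + f_h + (M u_h, h)_U) ds`
holds in `L₂((0,T);V')`. -/
def IsChaosSolution (tr : NormalTriple V H V') (T : ℝ) (P : Measure Ω) (W : U → Ω → ℝ)
    (e : HilbertBasis ι ℝ U) (A : ℝ → V →L[ℝ] V') (M : ℝ → V →L[ℝ] HilbertTensor V' U)
    (q : ι → ℝ) (u₀ : MultiIndex ι → H) (f : MultiIndex ι → TimeL2 T V')
    (q' : ι → ℝ) (r' : ℝ) (u : MultiIndex ι → TimeL2 T V) : Prop :=
  MemChaos q' r' u ∧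
  ∀ h : U, SufficientlySmall e q' h →
    MemChaosDual P W e q' r' (stochExp W h) →
    (∃ r, MemChaos q r u₀ ∧ MemChaosDual P W e q r (stochExp W h)) →
    (∃ r, MemChaos q r f ∧ MemChaosDual P W e q r (stochExp W h)) →
    let u_h : TimeL2 T V := chaosPairing P W e u (stochExp W h)
    let f_h : TimeL2 T V' := chaosPairing P W e f (stochExp W h)
    let u₀_h : H := chaosPairing P W e u₀ (stochExp W h)
    ∀ᵐ t ∂(timeMeasure T), tr.embHV' (tr.embVH (u_h t)) = tr.embHV' u₀_h +
      ∫ s in (0 : ℝ)..t, (A s (u_h s) + f_h s + innerU h (M s (u_h s)))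

/-- The propagator equation with index `α`, as an equality in `L₂((0,T);V')`. Here
`M_k = (M, e_k)_U`, and only the `k` with `α_k ≠ 0` contribute to the sum. -/
def PropagatorEq (tr : NormalTriple V H V') (T : ℝ)
    (e : HilbertBasis ι ℝ U) (A : ℝ → V →L[ℝ] V') (M : ℝ → V →L[ℝ] HilbertTensor V' U)
    (u₀ : MultiIndex ι → H) (f : MultiIndex ι → TimeL2 T V')
    (u : MultiIndex ι → TimeL2 T V) (α : MultiIndex ι) : Prop :=
  ∀ᵐ t ∂(timeMeasure T), tr.embHV' (tr.embVH (u α t)) = tr.embHV' (u₀ α) +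
    ∫ s in (0 : ℝ)..t, (A s (u α s) + f α s +
      α.sum fun k n => √(n : ℝ) • innerU (e k) (M s (u (α - Finsupp.single k 1) s)))

/-- `v ∈ L₂((0,T);V)` is an element of `C([0,T];H)`: it agrees almost everywhere with a continuous
`H`-valued function. -/
def IsContinuousInH (tr : NormalTriple V H V') (T : ℝ) (v : TimeL2 T V) : Prop :=
  ∃ g : ℝ → H, ContinuousOn g (Set.Icc 0 T) ∧ ∀ᵐ t ∂(timeMeasure T), tr.embVH (v t) = g t

end Equation

/-!
For `h ∈ U` the chaos coefficients of the stochastic exponential `ℰ_h` are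
`E (ℰ_h ξ_α) = h^α / √(α!)`, with `h^α = ∏ₖ (h, e_k)^{α_k}`
(`integral_stochExp_mul_chaosBasis`), so that the pairing `u_h` is the power series
`∑_α h^α / √(α!) u_α` in the coordinates of `h`. Since
`√(α_k) h^α / √(α!) = h_k h^{α-ε_k} / √((α-ε_k)!)`, multiplying `u_h` by `h_k` shifts its
coefficients to `√(α_k) u_{α-ε_k}` (`hasSum_expCoeff_shift`). Hence, for `h` in the span of finitely
many basis vectors, the defect of the equation for `u_h` is the power series whose coefficients are
the defects of the propagator equations (`hasSum_expCoeff_propagatorDefect`). All terms are images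
of `u`, `u⁰` and `f` under bounded operators from `L²((0,T);V)`, `H` and `L²((0,T);V')` to
`L²((0,T);V')`; the operators `A` and `M` are bounded between the `L²` spaces by the closed graph
theorem (`familyLp`), and `h ↦ (M x, h)_U` is bounded as well (`innerUL`).

If the propagator equations hold, the defect of the equation for `u_h` vanishes for all finite
partial sums of the expansion of `h`, and one passes to the limit by dominated convergence
(`eq_tsum_of_propagatorDefect_eq_zero`). Conversely, small combinations of finitely many basis
vectors are admissible test directions, because
`∑_α (h^{2α} / α!) |α|! q^{-2rα} = ∑ₙ (∑ₖ h_k² q_k^{-2r})ⁿ`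
(`summable_expCoeff_sq_div_chaosWeight`), and a power series in finitely many variables that
vanishes near the origin has vanishing coefficients (`eq_zero_of_hasSum_expCoeff_smul`).

Continuity of `u_α` in `H` is the Lions–Magenes lemma. With `V'` identified with `V` by the Riesz
isomorphism, and with `j : V → H` the embedding, the propagator equation becomes
`j†j u = j†c + ∫ g` with `u, g ∈ L²((0,T);V)`. The regularizations `j (j†j + ε)⁻¹ (j†c + ∫ g)` are
continuous in `H`; the energy identity, applied to the difference of two of them, together with the
strong convergence `(j†j + ε)⁻¹ j†j → 1` shows that they are uniformly Cauchy as `ε → 0`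
(`norm_sq_resolvent_sub_le`, `exists_continuousOn_of_adjoint_eq_integral`).
-/

/-! ### Chaos coefficients of the stochastic exponential -/

lemma integrable_exp_mul_eval_gaussianReal (t : ℝ) (p : Polynomial ℝ) :
    Integrable (fun x => Real.exp (t * x) * p.eval x) (gaussianReal 0 1) := by
  induction p using Polynomial.induction_on' with
  | add p q hp hq =>
    simp only [Polynomial.eval_add, mul_add]
    exact hp.add hq
  | monomial n a =>
    have h := integrable_pow_mul_exp_of_mem_interior_integrableExpSet (X := id)
      (μ := gaussianReal 0 1) (v := t) (by simp [integrableExpSet_id_gaussianReal]) n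
    refine (h.const_mul a).congr (ae_of_all _ fun x => ?_)
    simp only [id, Polynomial.eval_monomial]
    ring

/-- Gaussian integration by parts for `exp (t x) p(x)`: multiplication by `x` minus differentiation
of `p`, which takes `Hₙ` to `Hₙ₊₁`, multiplies the integral by `t`. -/
lemma integral_exp_mul_sub_derivative_gaussianReal (t : ℝ) (p : Polynomial ℝ) :
    ∫ x, Real.exp (t * x) * (Polynomial.X * p - p.derivative).eval x ∂(gaussianReal 0 1) =
      t * ∫ x, Real.exp (t * x) * p.eval x ∂(gaussianReal 0 1) := by
  have key : ∀ r : Polynomial ℝ, Integrable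
      (fun x => gaussianPDFReal 0 1 x * (Real.exp (t * x) * r.eval x)) := by
    intro r
    have h := integrable_exp_mul_eval_gaussianReal t r
    rw [gaussianReal_of_var_ne_zero _ one_ne_zero,
      integrable_withDensity_iff_integrable_smul' (measurable_gaussianPDF 0 1)
      (ae_of_all _ fun _ => gaussianPDF_lt_top)] at h
    simpa [toReal_gaussianPDF] using h
  have hderiv : ∀ x : ℝ, HasDerivAt
      (fun x => gaussianPDFReal 0 1 x * (Real.exp (t * x) * p.eval x))
      (gaussianPDFReal 0 1 x * (Real.exp (t * x) *
        (Polynomial.C t * p - (Polynomial.X * p - p.derivative)).eval x)) x := by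
    intro x
    have h1 : HasDerivAt (gaussianPDFReal 0 1) (-x * gaussianPDFReal 0 1 x) x := by
      rw [gaussianPDFReal_def]
      have : HasDerivAt (fun x : ℝ => -(x - 0) ^ 2 / (2 * ((1 : NNReal) : ℝ))) (-x) x := by
        convert! (((hasDerivAt_id x).sub_const 0).pow 2).neg.div_const (2 * ((1 : NNReal) : ℝ))
          using 1
        simp; ring
      convert! this.exp.const_mul ((√(2 * Real.pi * ((1 : NNReal) : ℝ)))⁻¹) using 1
      ring
    have h2 : HasDerivAt (fun x => Real.exp (t * x)) (Real.exp (t * x) * t) x := by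
      simpa using ((hasDerivAt_id x).const_mul t).exp
    convert! h1.mul (h2.mul (p.hasDerivAt x)) using 1
    simp
    ring
  have h0 := integral_eq_zero_of_hasDerivAt_of_integrable hderiv (key _) (key _)
  have hconv : ∀ r : Polynomial ℝ, ∫ x, Real.exp (t * x) * r.eval x ∂(gaussianReal 0 1) =
      ∫ x, gaussianPDFReal 0 1 x * (Real.exp (t * x) * r.eval x) := by
    intro r
    rw [integral_gaussianReal_eq_integral_smul one_ne_zero]
    rfl
  rw [hconv, hconv, ← integral_const_mul, ← sub_eq_zero, ← integral_sub (key _) ((key _).const_mul t),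
    ← neg_eq_zero, ← integral_neg]
  refine Eq.trans (integral_congr_ae (ae_of_all _ fun x => ?_)) h0
  simp
  ring

/-- The Hermite coefficients of the exponential: `E (exp (t ξ) Hₙ(ξ)) = tⁿ exp (t² / 2)`. -/
lemma integral_exp_mul_hermite_gaussianReal (t : ℝ) (n : ℕ) :
    ∫ x, Real.exp (t * x) * Polynomial.aeval x (Polynomial.hermite n) ∂(gaussianReal 0 1) =
      t ^ n * Real.exp (t ^ 2 / 2) := by
  induction n with
  | zero =>
    have := congrFun (mgf_fun_id_gaussianReal (μ := 0) (v := 1)) t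
    simpa [mgf] using this
  | succ n ih =>
    have h := integral_exp_mul_sub_derivative_gaussianReal t
      ((Polynomial.hermite n).map (Int.castRingHom ℝ))
    have he : ∀ r : Polynomial ℤ, ∀ x : ℝ,
        Polynomial.aeval x r = (r.map (Int.castRingHom ℝ)).eval x := by
      intro r x
      rw [Polynomial.eval_map]; rfl
    simp only [he] at ih ⊢
    rw [ih] at h
    rw [Polynomial.hermite_succ]
    simp only [Polynomial.map_sub, Polynomial.map_mul, Polynomial.map_X, ← Polynomial.derivative_map]
    rw [h]
    ring

lemma IsGaussianNoise.covariance_eq {Ω U : Type*} [MeasurableSpace Ω] [NormedAddCommGroup U]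
    [InnerProductSpace ℝ U] {P : Measure Ω} [IsProbabilityMeasure P] {W : U → Ω → ℝ}
    (hW : IsGaussianNoise P W) (g h : U) : cov[W g, W h; P] = ⟪g, h⟫_ℝ := by
  rw [covariance_eq_sub (hW.gaussian.hasGaussianLaw_eval g).memLp_two
    (hW.gaussian.hasGaussianLaw_eval h).memLp_two, hW.mean_zero, hW.mean_zero, ← hW.cov]
  simp

/-- The variables `W(e_k)`, `k ∈ F`, at `some k`, and the remainder `W(h) - ∑ₖ (e_k, h) W(e_k)` at
`none`. They are jointly Gaussian and uncorrelated, hence independent. -/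
noncomputable def noiseSplit {ι Ω U : Type*} [NormedAddCommGroup U] [InnerProductSpace ℝ U]
    (W : U → Ω → ℝ) (e : ι → U) (F : Finset ι) (h : U) : Option F → Ω → ℝ
  | none => fun ω => W h ω - ∑ k : F, ⟪e k, h⟫_ℝ * W (e k) ω
  | some k => W (e k)

section

variable {ι Ω U : Type*} [NormedAddCommGroup U] [InnerProductSpace ℝ U]

/-- The normalized monomial `s^α / √(α!)`, which is the coefficient of `ξ_α` in the chaos expansion
of the stochastic exponential of `h`, for `s k = (h, e_k)`. -/
noncomputable def expCoeff (s : ι → ℝ) (α : MultiIndex ι) : ℝ :=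
  α.prod fun k n => s k ^ n / √(n.factorial : ℝ)

/-- The factors of `exp (W(h) - ‖h‖² / 2) ξ_α` as functions of the independent variables
`noiseSplit W e α.support h`. -/
noncomputable def stochExpFactor (e : ι → U) (α : MultiIndex ι) (h : U) :
    Option α.support → ℝ → ℝ
  | none => fun x => Real.exp (x - ‖h‖ ^ 2 / 2)
  | some k => fun x => Real.exp (⟪e k, h⟫_ℝ * x) * Polynomial.aeval x (Polynomial.hermite (α k)) /
      √((α k).factorial : ℝ)

lemma stochExp_mul_chaosBasis (W : U → Ω → ℝ) (e : HilbertBasis ι ℝ U) (α : MultiIndex ι) (h : U)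
    (ω : Ω) : stochExp W h ω * chaosBasis W e α ω =
      ∏ i, stochExpFactor e α h i (noiseSplit W e α.support h i ω) := by
  rw [Fintype.prod_option]
  simp only [stochExpFactor, noiseSplit, mul_div_assoc]
  rw [Finset.prod_mul_distrib, ← Real.exp_sum, ← mul_assoc, ← Real.exp_add, stochExp, chaosBasis,
    Finsupp.prod, ← Finset.prod_coe_sort]
  congr 2
  ring

end

section

variable {ι Ω U : Type*} [MeasurableSpace Ω] [NormedAddCommGroup U] [InnerProductSpace ℝ U]
  {P : Measure Ω} {W : U → Ω → ℝ}

lemma IsGaussianNoise.hasGaussianLaw_noiseSplit (hW : IsGaussianNoise P W) (e : ι → U)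
    (F : Finset ι) (h : U) : HasGaussianLaw (fun ω => (noiseSplit W e F h · ω)) P := by
  classical
  have hp : IsGaussianProcess (noiseSplit W e F h) P := by
    refine hW.gaussian.of_isGaussianProcess fun s => ?_
    cases s with
    | none =>
      refine ⟨insert h (F.image e), ContinuousLinearMap.proj ⟨h, by simp⟩ -
        ∑ k : F, ⟪e k, h⟫_ℝ • ContinuousLinearMap.proj
          ⟨e k, Finset.mem_insert_of_mem (Finset.mem_image_of_mem e k.2)⟩, fun ω => ?_⟩
      simp [noiseSplit]
    | some k =>
      exact ⟨{e k}, ContinuousLinearMap.proj ⟨e k, by simp⟩, fun ω => by simp [noiseSplit]⟩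
  let L : ({i // i ∈ (Finset.univ : Finset (Option F))} → ℝ) →L[ℝ] (Option F → ℝ) :=
    ContinuousLinearMap.pi fun i => ContinuousLinearMap.proj ⟨i, Finset.mem_univ i⟩
  exact (hp.hasGaussianLaw Finset.univ).map L

lemma aemeasurable_noiseSplit (hW : IsGaussianNoise P W) (e : ι → U) (F : Finset ι) (h : U)
    (i : Option F) : AEMeasurable (noiseSplit W e F h i) P :=
  ((hW.hasGaussianLaw_noiseSplit e F h).eval i).aemeasurable

variable [IsProbabilityMeasure P]

lemma IsGaussianNoise.covariance_noiseSplit_none (hW : IsGaussianNoise P W) (e : ι → U)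
    (F : Finset ι) (h g : U) : cov[noiseSplit W e F h none, W g; P] =
      ⟪h, g⟫_ℝ - ∑ k : F, ⟪e k, h⟫_ℝ * ⟪e k, g⟫_ℝ := by
  have hL := fun g => (hW.gaussian.hasGaussianLaw_eval g).memLp_two
  have hS : ∀ k : F, MemLp (fun ω => ⟪e k, h⟫_ℝ * W (e k) ω) 2 P := fun k =>
    (hL (e k)).const_mul _
  simp only [noiseSplit]
  rw [covariance_fun_sub_left (hL h) (memLp_finsetSum _ fun k _ => hS k) (hL g),
    covariance_fun_sum_left hS (hL g)]
  simp only [covariance_const_mul_left, hW.covariance_eq]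

lemma covariance_noiseSplit_some (hW : IsGaussianNoise P W) {e : ι → U} (he : Orthonormal ℝ e)
    (F : Finset ι) (h : U) (k : F) : cov[noiseSplit W e F h none, W (e k); P] = 0 := by
  classical
  rw [hW.covariance_noiseSplit_none, sub_eq_zero, Finset.sum_eq_single k]
  · rw [real_inner_self_eq_norm_sq, he.1, real_inner_comm]; simp
  · intro j _ hj
    rw [he.2 fun h => hj (Subtype.ext h), mul_zero]
  · simp

lemma variance_noiseSplit_none (hW : IsGaussianNoise P W) {e : ι → U} (he : Orthonormal ℝ e)
    (F : Finset ι) (h : U) :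
    Var[noiseSplit W e F h none; P] = ‖h‖ ^ 2 - ∑ k : F, ⟪e k, h⟫_ℝ ^ 2 := by
  have hL := fun g => (hW.gaussian.hasGaussianLaw_eval g).memLp_two
  have hS : ∀ k : F, MemLp (fun ω => ⟪e k, h⟫_ℝ * W (e k) ω) 2 P := fun k =>
    (hL (e k)).const_mul _
  have hN := ((hW.hasGaussianLaw_noiseSplit e F h).eval none).memLp_two
  rw [← covariance_self hN.aemeasurable]
  change cov[noiseSplit W e F h none, fun ω => W h ω - ∑ k : F, ⟪e k, h⟫_ℝ * W (e k) ω; P] = _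
  rw [covariance_fun_sub_right hN (hL h) (memLp_finsetSum _ fun k _ => hS k),
    covariance_fun_sum_right hS hN]
  simp only [covariance_const_mul_right, covariance_noiseSplit_some hW he, mul_zero,
    Finset.sum_const_zero, sub_zero, hW.covariance_noiseSplit_none, real_inner_self_eq_norm_sq, sq]

lemma iIndepFun_noiseSplit (hW : IsGaussianNoise P W) {e : ι → U} (he : Orthonormal ℝ e)
    (F : Finset ι) (h : U) : iIndepFun (noiseSplit W e F h) P := by
  refine (hW.hasGaussianLaw_noiseSplit e F h).iIndepFun_of_covariance_eq_zero fun i j hij => ?_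
  match i, j with
  | none, none => exact absurd rfl hij
  | none, some k => exact covariance_noiseSplit_some hW he F h k
  | some k, none =>
    rw [covariance_comm]
    exact covariance_noiseSplit_some hW he F h k
  | some k, some l =>
    refine (hW.covariance_eq _ _).trans (he.2 fun hkl => hij ?_)
    rw [Subtype.ext hkl]

lemma continuous_stochExpFactor (e : ι → U) (α : MultiIndex ι) (h : U) (i : Option α.support) :
    Continuous (stochExpFactor e α h i) := by
  have hp : ∀ p : Polynomial ℤ, Continuous fun x : ℝ => Polynomial.aeval x p := fun p =>
    p.continuous_aeval
  cases i with
  | none => simp only [stochExpFactor]; fun_prop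
  | some k =>
    simp only [stochExpFactor]
    have := hp (Polynomial.hermite (α k))
    fun_prop

lemma IsGaussianNoise.map_eq_gaussianReal (hW : IsGaussianNoise P W) {e : ι → U}
    (he : Orthonormal ℝ e) (k : ι) : P.map (W (e k)) = gaussianReal 0 1 := by
  have hg := hW.gaussian.hasGaussianLaw_eval (e k)
  rw [hg.map_eq_gaussianReal, hW.mean_zero, ← covariance_self hg.aemeasurable, hW.covariance_eq,
    real_inner_self_eq_norm_sq, he.1]
  simp

lemma map_noiseSplit_none (hW : IsGaussianNoise P W) {e : ι → U} (he : Orthonormal ℝ e)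
    (F : Finset ι) (h : U) : P.map (noiseSplit W e F h none) =
      gaussianReal 0 (‖h‖ ^ 2 - ∑ k : F, ⟪e k, h⟫_ℝ ^ 2).toNNReal := by
  have hg : HasGaussianLaw (noiseSplit W e F h none) P :=
    (hW.hasGaussianLaw_noiseSplit e F h).eval none
  have hi := fun g => (hW.gaussian.hasGaussianLaw_eval g).integrable
  rw [hg.map_eq_gaussianReal, variance_noiseSplit_none hW he]
  congr 1
  simp only [noiseSplit]
  rw [integral_sub (hi h) (integrable_finsetSum _ fun k _ => (hi _).const_mul _),
    integral_finsetSum _ fun k _ => (hi _).const_mul _]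
  simp [integral_const_mul, hW.mean_zero]

lemma integrable_stochExpFactor (hW : IsGaussianNoise P W) {e : ι → U} (he : Orthonormal ℝ e)
    (α : MultiIndex ι) (h : U) (i : Option α.support) :
    Integrable (stochExpFactor e α h i) (P.map (noiseSplit W e α.support h i)) := by
  cases i with
  | none =>
    rw [map_noiseSplit_none hW he]
    have := (integrable_exp_mul_gaussianReal (μ := 0)
      (v := (‖h‖ ^ 2 - ∑ k : α.support, ⟪e k, h⟫_ℝ ^ 2).toNNReal) 1).mul_const
        (Real.exp (-(‖h‖ ^ 2 / 2)))
    simpa [stochExpFactor, sub_eq_add_neg, Real.exp_add] using this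
  | some k =>
    change Integrable _ (P.map (W (e k)))
    rw [hW.map_eq_gaussianReal he]
    have := (integrable_exp_mul_eval_gaussianReal ⟪e k, h⟫_ℝ
      ((Polynomial.hermite (α k)).map (Int.castRingHom ℝ))).div_const (√((α k).factorial : ℝ))
    simpa [stochExpFactor, Polynomial.eval_map, Polynomial.aeval_def] using this

lemma integrable_stochExp_mul_chaosBasis (hW : IsGaussianNoise P W) (e : HilbertBasis ι ℝ U)
    (α : MultiIndex ι) (h : U) :
    Integrable (fun ω => stochExp W h ω * chaosBasis W e α ω) P := by
  have hm := aemeasurable_noiseSplit hW e α.support h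
  have hI := Integrable.fintype_prod (f := stochExpFactor e α h)
    (μ := fun i => P.map (noiseSplit W e α.support h i))
    fun i => integrable_stochExpFactor hW e.orthonormal α h i
  rw [← (iIndepFun_noiseSplit hW e.orthonormal α.support h).map_fun_eq_pi_map hm] at hI
  have := hI.comp_aemeasurable (aemeasurable_pi_lambda _ hm)
  refine this.congr (ae_of_all _ fun ω => ?_)
  exact (stochExp_mul_chaosBasis W e α h ω).symm

/-- The chaos expansion of the stochastic exponential: `E (ℰ_h ξ_α) = h^α / √(α!)`. By independence
the expectation is a product of one-dimensional integrals, and the Gaussian factors cancel. -/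
lemma integral_stochExp_mul_chaosBasis (hW : IsGaussianNoise P W) (e : HilbertBasis ι ℝ U)
    (α : MultiIndex ι) (h : U) :
    ∫ ω, stochExp W h ω * chaosBasis W e α ω ∂P = expCoeff (fun k => ⟪e k, h⟫_ℝ) α := by
  have hm := aemeasurable_noiseSplit hW e α.support h
  simp only [stochExp_mul_chaosBasis]
  rw [(iIndepFun_noiseSplit hW e.orthonormal α.support h).integral_fun_prod_comp hm fun i =>
    (continuous_stochExpFactor e α h i).aestronglyMeasurable, Fintype.prod_option]
  have h0 : ∫ ω, stochExpFactor e α h none (noiseSplit W e α.support h none ω) ∂P =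
      Real.exp (-∑ k : α.support, ⟪e k, h⟫_ℝ ^ 2 / 2) := by
    have hv : 0 ≤ ‖h‖ ^ 2 - ∑ k : α.support, ⟪e k, h⟫_ℝ ^ 2 := by
      rw [← variance_noiseSplit_none hW e.orthonormal]
      exact variance_nonneg _ _
    have := mgf_gaussianReal (map_noiseSplit_none hW e.orthonormal α.support h) 1
    simp only [mgf, one_mul, Real.coe_toNNReal _ hv] at this
    simp only [stochExpFactor, Real.exp_sub, integral_div, this]
    rw [← Real.exp_sub, ← Finset.sum_div]
    congr 1
    ring
  have h1 : ∀ k : α.support,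
      ∫ ω, stochExpFactor e α h (some k) (noiseSplit W e α.support h (some k) ω) ∂P =
      ⟪e k, h⟫_ℝ ^ α k / √((α k).factorial : ℝ) * Real.exp (⟪e k, h⟫_ℝ ^ 2 / 2) := by
    intro k
    rw [← integral_map (hm (some k)) (continuous_stochExpFactor e α h _).aestronglyMeasurable]
    change ∫ x, _ ∂(P.map (W (e k))) = _
    rw [hW.map_eq_gaussianReal e.orthonormal]
    simp only [stochExpFactor, integral_div, integral_exp_mul_hermite_gaussianReal]
    ring
  simp only [h0, h1]
  rw [Finset.prod_mul_distrib, ← Real.exp_sum, mul_left_comm, ← Real.exp_add, neg_add_cancel,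
    Real.exp_zero, mul_one]
  exact Finset.prod_coe_sort α.support fun k => ⟪e k, h⟫_ℝ ^ α k / √((α k).factorial : ℝ)

end

/-! ### Weighted spaces of chaos coefficients and their duals -/

section

variable {ι : Type*}

lemma chaosWeight_pos {q : ι → ℝ} (hq : IsWeight q) (r : ℝ) (α : MultiIndex ι) :
    0 < chaosWeight q r α := by
  refine div_pos (Finset.prod_pos fun k _ => Real.rpow_pos_of_pos ?_ _) (by positivity)
  exact zero_lt_one.trans_le (hq k)

lemma expCoeff_eq_prod (s : ι → ℝ) {α : MultiIndex ι} {F : Finset ι} (hα : α.support ⊆ F) :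
    expCoeff s α = ∏ k ∈ F, s k ^ α k / √((α k).factorial : ℝ) :=
  Finsupp.prod_of_support_subset _ hα _ (by simp)

lemma expCoeff_eq_zero {s : ι → ℝ} {α : MultiIndex ι} {F : Finset ι}
    (hs : ∀ k ∉ F, s k = 0) (hα : ¬α.support ⊆ F) : expCoeff s α = 0 := by
  obtain ⟨k, hk, hkF⟩ := Finset.not_subset.mp hα
  refine Finset.prod_eq_zero hk ?_
  change s k ^ α k / √((α k).factorial : ℝ) = 0
  rw [hs k hkF, zero_pow (Finsupp.mem_support_iff.mp hk), zero_div]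

lemma expCoeff_sq_div_chaosWeight (s q : ι → ℝ) (hq : IsWeight q) (r : ℝ) {α : MultiIndex ι}
    {F : Finset ι} (hα : α.support ⊆ F) :
    expCoeff s α ^ 2 / chaosWeight q r α =
      Nat.multinomial F α * ∏ k ∈ F, (s k ^ 2 / q k ^ (2 * r)) ^ α k := by
  have hdeg : α.degree = ∑ k ∈ F, α k := by
    rw [Finsupp.degree]
    exact Finset.sum_subset hα fun k _ hk => by simpa using hk
  have hw : chaosWeight q r α =
      (∏ k ∈ F, (q k ^ (2 * r)) ^ α k) / ((∑ k ∈ F, α k).factorial : ℝ) := by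
    rw [chaosWeight, hdeg, Finsupp.prod_of_support_subset _ hα _ (by simp)]
    congr 1
    refine Finset.prod_congr rfl fun k _ => ?_
    rw [Real.rpow_mul (zero_le_one.trans (hq k)), Real.rpow_natCast]
  have hc : expCoeff s α ^ 2 = (∏ k ∈ F, (s k ^ 2) ^ α k) / ∏ k ∈ F, ((α k).factorial : ℝ) := by
    rw [expCoeff_eq_prod s hα, ← Finset.prod_pow, ← Finset.prod_div_distrib]
    refine Finset.prod_congr rfl fun k _ => ?_
    rw [div_pow, Real.sq_sqrt (Nat.cast_nonneg _), ← pow_mul, ← pow_mul, mul_comm]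
  have hm : (∏ k ∈ F, ((α k).factorial : ℝ)) * Nat.multinomial F α =
      ((∑ k ∈ F, α k).factorial : ℝ) := by
    exact_mod_cast Nat.multinomial_spec F α
  have h0 : (∏ k ∈ F, ((α k).factorial : ℝ)) ≠ 0 :=
    Finset.prod_ne_zero_iff.mpr fun k _ => by positivity
  simp only [div_pow, Finset.prod_div_distrib]
  rw [hc, hw, ← hm]
  field_simp

/-- By the multinomial theorem, `∑ (s^{2α} / α!) / w_α = ∑ₙ (∑ₖ s_k² q_k^{-2r})ⁿ` for the weight
`w_α` of `(L)_{q,r}`. -/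
lemma summable_expCoeff_sq_div_chaosWeight {s q : ι → ℝ} (hq : IsWeight q) (r : ℝ) {F : Finset ι}
    (hs : ∀ k ∉ F, s k = 0) (hlt : ∑ k ∈ F, s k ^ 2 * (q k ^ (2 * r))⁻¹ < 1) :
    Summable fun α => expCoeff s α ^ 2 / chaosWeight q r α := by
  classical
  simp only [← div_eq_mul_inv] at hlt
  set y : ι → ℝ := fun k => s k ^ 2 / q k ^ (2 * r) with hy
  have hy0 : ∀ k, 0 ≤ y k := fun k =>
    div_nonneg (sq_nonneg _) (Real.rpow_nonneg (zero_le_one.trans (hq k)) _)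
  have hsum0 : 0 ≤ ∑ k ∈ F, y k := Finset.sum_nonneg fun k _ => hy0 k
  have hnn : ∀ α, 0 ≤ expCoeff s α ^ 2 / chaosWeight q r α := fun α =>
    div_nonneg (sq_nonneg _) (chaosWeight_pos hq r α).le
  refine summable_of_sum_le hnn (c := ∑' n : ℕ, (∑ k ∈ F, y k) ^ n) fun S => ?_
  have hfib : ∀ n, ∑ α ∈ S with α.degree = n, expCoeff s α ^ 2 / chaosWeight q r α ≤
      (∑ k ∈ F, y k) ^ n := by
    intro n
    -- only the indices supported in `F` contribute, and they are part of the multinomial expansion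
    rw [Finset.sum_pow_eq_sum_piAntidiag,
      ← Finset.sum_filter_of_ne (p := fun α => α.support ⊆ F)]
    · rw [Finset.sum_congr rfl fun α hα =>
        expCoeff_sq_div_chaosWeight s q hq r (Finset.mem_filter.mp hα).2]
      rw [← Finset.sum_image (f := fun g : ι → ℕ => (Nat.multinomial F g : ℝ) *
        ∏ k ∈ F, y k ^ g k) (g := fun α : MultiIndex ι => (α : ι → ℕ))
        (DFunLike.coe_injective.injOn)]
      refine Finset.sum_le_sum_of_subset_of_nonneg ?_ fun g _ _ =>
        mul_nonneg (Nat.cast_nonneg _) (Finset.prod_nonneg fun k _ => pow_nonneg (hy0 k) _)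
      intro g hg
      obtain ⟨α, hα, rfl⟩ := Finset.mem_image.mp hg
      simp only [Finset.mem_filter] at hα
      rw [Finset.mem_piAntidiag]
      refine ⟨?_, fun k hk => hα.2 (Finsupp.mem_support_iff.mpr hk)⟩
      rw [← hα.1.2, Finsupp.degree]
      exact (Finset.sum_subset hα.2 fun k _ hk => by simpa using hk).symm
    · intro α _ hne
      by_contra hα
      exact hne (by rw [expCoeff_eq_zero hs hα]; simp)
  rw [← Finset.sum_fiberwise_of_maps_to (t := S.image Finsupp.degree)
    (g := Finsupp.degree) fun α hα => Finset.mem_image_of_mem _ hα]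
  exact (Finset.sum_le_sum fun n _ => hfib n).trans
    ((summable_geometric_of_lt_one hsum0 hlt).sum_le_tsum _ fun n _ => pow_nonneg hsum0 n)

lemma exists_pos_forall_sum_sq_mul_lt_one (F : Finset ι) (a : ι → ℝ) :
    ∃ δ > 0, ∀ s : ι → ℝ, (∀ k ∈ F, |s k| ≤ δ) → ∑ k ∈ F, s k ^ 2 * a k < 1 := by
  set A := ∑ k ∈ F, |a k|
  have hA : 0 ≤ A := Finset.sum_nonneg fun k _ => abs_nonneg _
  -- `A / (A + 1)² < 1`
  refine ⟨1 / (A + 1), by positivity, fun s hs => ?_⟩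
  have h1 : ∑ k ∈ F, s k ^ 2 * a k ≤ ∑ k ∈ F, (1 / (A + 1)) ^ 2 * |a k| := by
    refine Finset.sum_le_sum fun k hk => ?_
    refine (mul_le_mul_of_nonneg_left (le_abs_self _) (sq_nonneg _)).trans ?_
    refine mul_le_mul_of_nonneg_right ?_ (abs_nonneg _)
    rw [← sq_abs]
    exact pow_le_pow_left₀ (abs_nonneg _) (hs k hk) 2
  refine h1.trans_lt ?_
  rw [← Finset.mul_sum, div_pow, one_pow, one_div, inv_mul_lt_iff₀ (by positivity)]
  change A < _
  nlinarith

/-- Absolute convergence of the pairing of a weighted `ℓ²` space with its dual. -/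
lemma Summable.abs_mul_norm_of_weighted {κ X : Type*} [NormedAddCommGroup X] {w c : κ → ℝ}
    {η : κ → X} (hw : ∀ α, 0 < w α) (hc : Summable fun α => c α ^ 2 / w α)
    (hη : Summable fun α => w α * ‖η α‖ ^ 2) : Summable fun α => |c α| * ‖η α‖ := by
  refine Summable.of_nonneg_of_le (fun α => by positivity) (fun α => ?_) (hc.add hη)
  have h := two_mul_le_add_sq (|c α| / √(w α)) (√(w α) * ‖η α‖)
  have hs : √(w α) ≠ 0 := (Real.sqrt_pos.mpr (hw α)).ne'
  rw [div_pow, mul_pow, Real.sq_sqrt (hw α).le, sq_abs] at h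
  have h2 : 2 * (|c α| / √(w α)) * (√(w α) * ‖η α‖) = 2 * (|c α| * ‖η α‖) := by
    field_simp
  rw [h2] at h
  have : 0 ≤ |c α| * ‖η α‖ := by positivity
  linarith

section

variable {Ω U : Type*} [MeasurableSpace Ω] [NormedAddCommGroup U] [InnerProductSpace ℝ U]
  {P : Measure Ω} [IsProbabilityMeasure P] {W : U → Ω → ℝ}

lemma integral_sum_chaosBasis_mul_stochExp (hW : IsGaussianNoise P W) (e : HilbertBasis ι ℝ U)
    (h : U) (η : MultiIndex ι →₀ ℝ) :
    ∫ ω, (η.sum fun α c => c * chaosBasis W e α ω) * stochExp W h ω ∂P =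
      η.sum fun α c => c * expCoeff (fun k => ⟪e k, h⟫_ℝ) α := by
  simp only [Finsupp.sum, Finset.sum_mul]
  rw [integral_finsetSum]
  · refine Finset.sum_congr rfl fun α _ => ?_
    rw [← integral_stochExp_mul_chaosBasis hW, ← integral_const_mul]
    refine integral_congr_ae (ae_of_all _ fun ω => ?_)
    ring
  · intro α _
    refine ((integrable_stochExp_mul_chaosBasis hW e α h).const_mul (η α)).congr
      (ae_of_all _ fun ω => ?_)
    ring

/-- The stochastic exponential of `h` lies in the dual of `(L)_{q,r}` if and only if its
coefficients are square summable with respect to the inverse weights. -/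
lemma memChaosDual_stochExp_iff (hW : IsGaussianNoise P W) (e : HilbertBasis ι ℝ U)
    {q : ι → ℝ} (hq : IsWeight q) (r : ℝ) (h : U) :
    MemChaosDual P W e q r (stochExp W h) ↔
      Summable fun α => expCoeff (fun k => ⟪e k, h⟫_ℝ) α ^ 2 / chaosWeight q r α := by
  classical
  simp only [MemChaosDual, integral_sum_chaosBasis_mul_stochExp hW]
  set c := expCoeff fun k => ⟪e k, h⟫_ℝ
  have hw := chaosWeight_pos hq r
  set w := chaosWeight q r
  have hnn : ∀ α, 0 ≤ c α ^ 2 / w α := fun α => div_nonneg (sq_nonneg _) (hw α).le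
  constructor
  · rintro ⟨C, hC⟩
    refine summable_of_sum_le hnn (c := C ^ 2) fun S => ?_
    -- the extremal test element has the coefficients `c α / w α`
    have hη := hC (Finsupp.onFinset S (fun α => if α ∈ S then c α / w α else 0) (by simp_all))
    rw [Finsupp.onFinset_sum _ (by simp), Finsupp.onFinset_sum _ (by simp)] at hη
    rw [Finset.sum_congr rfl fun α hα => show (if α ∈ S then c α / w α else 0) * c α =
        c α ^ 2 / w α by rw [if_pos hα]; ring,
      Finset.sum_congr rfl fun α hα => show w α * (if α ∈ S then c α / w α else 0) ^ 2 =
        c α ^ 2 / w α by rw [if_pos hα]; have := (hw α).ne'; field_simp] at hη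
    have hX : 0 ≤ ∑ α ∈ S, c α ^ 2 / w α := Finset.sum_nonneg fun α _ => hnn α
    rw [abs_of_nonneg hX] at hη
    have hsq := Real.sq_sqrt hX
    rcases hX.eq_or_lt with h0 | hpos
    · rw [← h0]; positivity
    · have : √(∑ α ∈ S, c α ^ 2 / w α) ≤ C := by
        have hsp := Real.sqrt_pos.mpr hpos
        nlinarith
      rw [← hsq]
      exact pow_le_pow_left₀ (Real.sqrt_nonneg _) this 2
  · intro hs
    refine ⟨√(∑' α, c α ^ 2 / w α), fun η => ?_⟩
    rw [← Real.sqrt_mul (tsum_nonneg hnn)]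
    refine Real.abs_le_sqrt ?_
    have hcs := Finset.sum_mul_sq_le_sq_mul_sq η.support (fun α => c α / √(w α))
      (fun α => √(w α) * η α)
    have h1 : ∀ α, c α / √(w α) * (√(w α) * η α) = η α * c α := by
      intro α
      have := (Real.sqrt_pos.mpr (hw α)).ne'
      field_simp
    simp only [h1, div_pow, mul_pow, Real.sq_sqrt (hw _).le] at hcs
    refine hcs.trans (mul_le_mul_of_nonneg_right (hs.sum_le_tsum _ fun α _ => hnn α) ?_)
    exact Finset.sum_nonneg fun α _ => mul_nonneg (hw α).le (sq_nonneg _)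

lemma inner_sum_smul_hilbertBasis [DecidableEq ι] (e : HilbertBasis ι ℝ U) (F : Finset ι)
    (s : ι → ℝ) (k : ι) :
    ⟪e k, ∑ j ∈ F, s j • e j⟫_ℝ = if k ∈ F then s k else 0 := by
  rw [inner_sum]
  simp only [inner_smul_right, orthonormal_iff_ite.mp e.orthonormal, mul_ite, mul_one, mul_zero]
  exact Finset.sum_ite_eq F k s

lemma sufficientlySmall_sum_smul (e : HilbertBasis ι ℝ U) {q : ι → ℝ} {F : Finset ι} {s : ι → ℝ}
    (hlt : ∑ k ∈ F, s k ^ 2 * q k ^ 2 < 1) :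
    SufficientlySmall e q (∑ j ∈ F, s j • e j) := by
  classical
  have h0 : ∀ k ∉ F, (q k ^ (1 : ℝ) * ⟪e k, ∑ j ∈ F, s j • e j⟫_ℝ) ^ 2 = 0 := by
    intro k hk
    rw [inner_sum_smul_hilbertBasis, if_neg hk]
    simp
  refine ⟨1, one_pos, summable_of_ne_finset_zero h0, ?_⟩
  rw [tsum_eq_sum h0, Real.sqrt_lt' one_pos, one_pow]
  refine lt_of_eq_of_lt (Finset.sum_congr rfl fun k hk => ?_) hlt
  rw [inner_sum_smul_hilbertBasis, if_pos hk, Real.rpow_one]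
  ring

end

end

/-! ### Uniqueness of power series coefficients in finitely many variables -/

section

variable {ι : Type*}

lemma eq_zero_of_hasSum_pow_mul {a : ℕ → ℝ}
    (h : ∀ t : ℝ, |t| ≤ 1 → HasSum (fun n => t ^ n * a n) 0) (n : ℕ) : a n = 0 := by
  have hp : HasFPowerSeriesAt (0 : ℝ → ℝ) (FormalMultilinearSeries.ofScalars ℝ a) 0 := by
    rw [hasFPowerSeriesAt_iff]
    filter_upwards [Metric.ball_mem_nhds (0 : ℝ) one_pos] with t ht
    simpa using h t (by simpa using (Metric.mem_ball.mp ht).le)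
  have := congrArg (fun p => FormalMultilinearSeries.coeff p n) hp.eq_zero
  rwa [FormalMultilinearSeries.coeff_ofScalars, FormalMultilinearSeries.coeff_eq_zero.mpr rfl] at this

lemma expCoeff_const_mul (t : ℝ) (s : ι → ℝ) (α : MultiIndex ι) :
    expCoeff (fun k => t * s k) α = t ^ α.degree * expCoeff s α := by
  simp only [expCoeff, Finsupp.prod]
  rw [show α.degree = ∑ k ∈ α.support, α k from rfl, ← Finset.prod_pow_eq_pow_sum, ← Finset.prod_mul_distrib]
  refine Finset.prod_congr rfl fun k _ => ?_
  rw [mul_pow, mul_div_assoc]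

/-- The homogeneous parts of a vanishing power series in finitely many variables vanish. -/
lemma sum_finsuppAntidiag_expCoeff_mul_eq_zero [DecidableEq ι] {F : Finset ι} {s : ι → ℝ}
    (hs : ∀ k ∉ F, s k = 0) {d : MultiIndex ι → ℝ}
    (h : ∀ t : ℝ, |t| ≤ 1 → HasSum (fun α => expCoeff (fun k => t * s k) α * d α) 0) (n : ℕ) :
    ∑ α ∈ F.finsuppAntidiag n, expCoeff s α * d α = 0 := by
  refine eq_zero_of_hasSum_pow_mul
    (a := fun n => ∑ α ∈ F.finsuppAntidiag n, expCoeff s α * d α) (fun t ht => ?_) n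
  have h1 := (Equiv.sigmaFiberEquiv (Finsupp.degree : MultiIndex ι → ℕ)).hasSum_iff.mpr (h t ht)
  refine h1.sigma fun m => ?_
  have h2 : HasSum (Set.indicator {α : MultiIndex ι | α.degree = m}
      fun α => expCoeff (fun k => t * s k) α * d α)
      (t ^ m * ∑ α ∈ F.finsuppAntidiag m, expCoeff s α * d α) := by
    have : t ^ m * ∑ α ∈ F.finsuppAntidiag m, expCoeff s α * d α =
        ∑ α ∈ F.finsuppAntidiag m, Set.indicator {α : MultiIndex ι | α.degree = m}
          (fun α => expCoeff (fun k => t * s k) α * d α) α := by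
      rw [Finset.mul_sum]
      refine Finset.sum_congr rfl fun α hα => ?_
      rw [Finset.mem_finsuppAntidiag'] at hα
      have hdeg : α.degree = m := hα.1
      rw [Set.indicator_of_mem (by exact hdeg), expCoeff_const_mul, hdeg, mul_assoc]
    rw [this]
    refine hasSum_sum_of_ne_finset_zero fun α hα => ?_
    by_cases hdeg : α.degree = m
    · rw [Set.indicator_of_mem (by exact hdeg), expCoeff_eq_zero (F := F), zero_mul]
      · intro k hk
        rw [hs k hk, mul_zero]
      · intro hsub
        exact hα (Finset.mem_finsuppAntidiag'.mpr ⟨hdeg, hsub⟩)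
    · exact Set.indicator_of_notMem (by exact hdeg) _
  exact hasSum_subtype_iff_indicator.mpr h2

/-- A power series in finitely many variables that vanishes near the origin has vanishing
coefficients. -/
lemma eq_zero_of_hasSum_expCoeff_mul {F : Finset ι} {δ : ℝ} (hδ : 0 < δ) {d : MultiIndex ι → ℝ}
    (h : ∀ s : ι → ℝ, (∀ k ∉ F, s k = 0) → (∀ k, |s k| ≤ δ) →
      HasSum (fun α => expCoeff s α * d α) 0) {α : MultiIndex ι} (hα : α.support ⊆ F) :
    d α = 0 := by
  classical
  set b : MultiIndex ι → ℝ := fun α => d α / ∏ k ∈ α.support, √((α k).factorial : ℝ)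
  set n := α.degree
  set p : MvPolynomial ι ℝ := ∑ β ∈ F.finsuppAntidiag n, MvPolynomial.monomial β (b β)
  have hp : p = 0 := by
    refine MvPolynomial.funext_set (fun _ => Set.Icc (-δ) δ)
      (fun _ => Set.Icc_infinite (by linarith)) fun x hx => ?_
    have hx' : ∀ k, |x k| ≤ δ := fun k => abs_le.mpr (hx k trivial)
    have hs0 : ∀ k ∉ F, (if k ∈ F then x k else 0) = 0 := fun k hk => if_neg hk
    have := sum_finsuppAntidiag_expCoeff_mul_eq_zero hs0 (d := d) (fun t ht => ?_) n
    · rw [map_zero, ← this]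
      simp only [p, map_sum, MvPolynomial.eval_monomial]
      refine Finset.sum_congr rfl fun β hβ => ?_
      have hβF := (Finset.mem_finsuppAntidiag'.mp hβ).2
      simp only [b, expCoeff, Finsupp.prod, Finset.prod_div_distrib]
      rw [Finset.prod_congr rfl fun k hk =>
        show (if k ∈ F then x k else 0) ^ β k = x k ^ β k by rw [if_pos (hβF hk)]]
      ring
    · refine h _ (fun k hk => by rw [if_neg hk, mul_zero]) fun k => ?_
      rw [abs_mul]
      refine (mul_le_mul ht (?_ : _ ≤ δ) (abs_nonneg _) zero_le_one).trans (one_mul δ).le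
      split_ifs
      · exact hx' k
      · simpa using hδ.le
  have hc : b α = 0 := by
    have := congrArg (MvPolynomial.coeff α) hp
    simp only [p, MvPolynomial.coeff_sum, MvPolynomial.coeff_monomial, MvPolynomial.coeff_zero]
      at this
    have hmem : α ∈ F.finsuppAntidiag n := Finset.mem_finsuppAntidiag'.mpr ⟨rfl, hα⟩
    rwa [Finset.sum_ite_eq', if_pos hmem] at this
  refine (div_eq_zero_iff.mp hc).resolve_right (Finset.prod_ne_zero_iff.mpr fun k _ => ?_)
  positivity

/-- The vector-valued form of `eq_zero_of_hasSum_expCoeff_mul`. -/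
lemma eq_zero_of_hasSum_expCoeff_smul {Y : Type*} [NormedAddCommGroup Y] [NormedSpace ℝ Y]
    {F : Finset ι} {δ : ℝ} (hδ : 0 < δ) {d : MultiIndex ι → Y}
    (h : ∀ s : ι → ℝ, (∀ k ∉ F, s k = 0) → (∀ k, |s k| ≤ δ) →
      HasSum (fun α => expCoeff s α • d α) 0) {α : MultiIndex ι} (hα : α.support ⊆ F) :
    d α = 0 := by
  refine SeparatingDual.eq_zero_of_forall_dual_eq_zero (R := ℝ) fun φ => ?_
  refine eq_zero_of_hasSum_expCoeff_mul hδ (d := fun α => φ (d α)) (fun s hs hs' => ?_) hα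
  simpa using (h s hs hs').mapL φ

end

/-! ### Energy identity and resolvents of `j†j` -/

section

open Filter Topology

/-- The energy identity for the primitive of an integrable function. -/
lemma norm_sq_add_integral {H : Type*} [NormedAddCommGroup H] [InnerProductSpace ℝ H]
    [CompleteSpace H] {k : ℝ → H} {t : ℝ} (hk : IntervalIntegrable k volume 0 t)
    (y₀ : H) :
    ‖y₀ + ∫ s in (0 : ℝ)..t, k s‖ ^ 2 =
      ‖y₀‖ ^ 2 + ∫ s in (0 : ℝ)..t, 2 * ⟪y₀ + ∫ r in (0 : ℝ)..s, k r, k s⟫_ℝ := by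
  set y : ℝ → H := fun s => y₀ + ∫ r in (0 : ℝ)..s, k r with hy
  have hsub : ∀ a ∈ Set.uIcc 0 t, ∀ b ∈ Set.uIcc 0 t, IntervalIntegrable k volume a b :=
    fun a ha b hb => hk.mono_set (Set.uIcc_subset_uIcc ha hb)
  have h0 : (0 : ℝ) ∈ Set.uIcc 0 t := Set.left_mem_uIcc
  have hyc : ContinuousOn y (Set.uIcc 0 t) :=
    continuousOn_const.add
      (intervalIntegral.continuousOn_primitive_interval' hk Set.left_mem_uIcc)
  obtain ⟨R, hR⟩ := isCompact_uIcc.exists_bound_of_continuousOn hyc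
  have hR0 : 0 ≤ R := (norm_nonneg _).trans (hR 0 h0)
  have hN : AbsolutelyContinuousOnInterval (fun s => ∫ r in (0 : ℝ)..s, ‖k r‖) 0 t :=
    hk.norm.absolutelyContinuousOnInterval_intervalIntegral h0
  have hdist : ∀ a ∈ Set.uIcc 0 t, ∀ b ∈ Set.uIcc 0 t,
      dist (‖y a‖ ^ 2) (‖y b‖ ^ 2) ≤
        2 * R * dist (∫ r in (0 : ℝ)..a, ‖k r‖) (∫ r in (0 : ℝ)..b, ‖k r‖) := by
    intro a ha b hb
    have h1 : ‖y a - y b‖ ≤ |(∫ r in (0 : ℝ)..a, ‖k r‖) - ∫ r in (0 : ℝ)..b, ‖k r‖| := by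
      simp only [hy, add_sub_add_left_eq_sub]
      rw [intervalIntegral.integral_interval_sub_left (hsub 0 h0 a ha) (hsub 0 h0 b hb),
        intervalIntegral.integral_interval_sub_left (hsub 0 h0 a ha).norm (hsub 0 h0 b hb).norm]
      exact intervalIntegral.norm_integral_le_abs_integral_norm
    have h2 : |‖y a‖ - ‖y b‖| ≤ ‖y a - y b‖ := abs_norm_sub_norm_le _ _
    rw [Real.dist_eq, Real.dist_eq, sq_sub_sq, abs_mul, abs_of_nonneg (by positivity)]
    refine mul_le_mul ?_ (h2.trans h1) (abs_nonneg _) (by positivity)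
    linarith [hR a ha, hR b hb]
  -- `‖y‖²` inherits absolute continuity from the primitive of `‖k‖`
  have hac : AbsolutelyContinuousOnInterval (fun s => ‖y s‖ ^ 2) 0 t := by
    refine squeeze_zero' (Eventually.of_forall fun E => Finset.sum_nonneg fun _ _ => dist_nonneg)
      ?_ (hN.const_mul (2 * R))
    filter_upwards [mem_inf_of_right (mem_principal_self _)] with E hE
    refine Finset.sum_le_sum fun i hi => ?_
    refine (hdist _ (hE.1 i hi).1 _ (hE.1 i hi).2).trans (le_of_eq ?_)
    simp only [Real.dist_eq, ← mul_sub, abs_mul, abs_of_nonneg hR0]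
    simp
  have hderiv := hac.integral_deriv_eq_sub
  have hy0 : y 0 = y₀ := by simp [hy]
  rw [hy0] at hderiv
  rw [← sub_eq_iff_eq_add', ← hderiv]
  refine intervalIntegral.integral_congr_ae ?_
  filter_upwards [hk.ae_hasDerivAt_integral] with s hs hst
  have hd := (hs (Set.uIoc_subset_uIcc hst) 0 h0).const_add y₀
  exact hd.norm_sq.deriv

/-- For uniformly bounded operators, strong convergence to zero can be checked on a dense set. -/
lemma tendsto_zero_of_denseRange {Z V X : Type*} [NormedAddCommGroup V] [NormedSpace ℝ V]
    [NormedAddCommGroup X] [NormedSpace ℝ X]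
    {S : ℕ → V →L[ℝ] X} {C : ℝ} (hS : ∀ n v, ‖S n v‖ ≤ C * ‖v‖) {φ : Z → V}
    (hφ : DenseRange φ) (h : ∀ z, Tendsto (fun n => S n (φ z)) atTop (𝓝 0)) (v : V) :
    Tendsto (fun n => S n v) atTop (𝓝 0) := by
  rw [Metric.tendsto_atTop]
  intro ε hε
  have hC : 0 < |C| + 1 := by positivity
  obtain ⟨z, hz⟩ := hφ.exists_dist_lt v (ε := ε / 2 / (|C| + 1)) (by positivity)
  obtain ⟨N, hN⟩ := Metric.tendsto_atTop.mp (h z) (ε / 2) (by positivity)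
  refine ⟨N, fun n hn => ?_⟩
  have h1 := hN n hn
  rw [dist_zero_right] at h1 ⊢
  have h2 : ‖S n (v - φ z)‖ ≤ ε / 2 := by
    refine (hS n _).trans ?_
    rw [← dist_eq_norm]
    rw [lt_div_iff₀ hC] at hz
    nlinarith [le_abs_self C, dist_nonneg (x := v) (y := φ z)]
  have h3 : S n v = S n (v - φ z) + S n (φ z) := by rw [map_sub]; abel
  rw [h3]
  exact (norm_add_le _ _).trans_lt (by linarith)

section Resolvent

variable {V H : Type*} [NormedAddCommGroup V] [InnerProductSpace ℝ V] [CompleteSpace V]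
  [NormedAddCommGroup H] [InnerProductSpace ℝ H] [CompleteSpace H]

/-- `S` is the two-sided inverse of `j†j + ε`. -/
structure IsResolvent (j : V →L[ℝ] H) (ε : ℝ) (S : V →L[ℝ] V) : Prop where
  left_inv : ∀ v, S (j.adjoint (j v) + ε • v) = v
  right_inv : ∀ v, j.adjoint (j (S v)) + ε • S v = v

lemma exists_isResolvent (j : V →L[ℝ] H) {ε : ℝ} (hε : 0 < ε) :
    ∃ S : V →L[ℝ] V, IsResolvent j ε S := by
  set E : V →L[ℝ] V := j.adjoint.comp j + ε • ContinuousLinearMap.id ℝ V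
  have hE : ∀ v, E v = j.adjoint (j v) + ε • v := fun v => rfl
  have hco : IsCoercive ((innerSL ℝ).comp E) := by
    refine ⟨ε, hε, fun v => ?_⟩
    have : ((innerSL ℝ).comp E) v v = ‖j v‖ ^ 2 + ε * ‖v‖ ^ 2 := by
      change ⟪E v, v⟫_ℝ = _
      rw [hE, inner_add_left, ContinuousLinearMap.adjoint_inner_left, inner_smul_left,
        real_inner_self_eq_norm_sq, real_inner_self_eq_norm_sq]
      rfl
    rw [this]
    nlinarith [sq_nonneg ‖j v‖]
  have heq : ∀ v, hco.continuousLinearEquivOfBilin v = E v := fun v =>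
    (hco.unique_continuousLinearEquivOfBilin fun w => rfl).symm
  refine ⟨hco.continuousLinearEquivOfBilin.symm, fun v => ?_, fun v => ?_⟩
  · rw [← hE, ← heq]
    exact hco.continuousLinearEquivOfBilin.symm_apply_apply v
  · rw [← hE]
    exact (heq _).symm.trans (hco.continuousLinearEquivOfBilin.apply_symm_apply v)

namespace IsResolvent

variable {j : V →L[ℝ] H} {ε : ℝ} {S : V →L[ℝ] V}

lemma comm (h : IsResolvent j ε S) (v : V) : S (j.adjoint (j v)) = j.adjoint (j (S v)) := by
  have h1 : j.adjoint (j v) =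
      j.adjoint (j (j.adjoint (j (S v)))) + ε • j.adjoint (j (S v)) := by
    conv_lhs => rw [← h.right_inv v]
    simp only [map_add, map_smul]
  rw [h1, h.left_inv]

lemma norm_sq_eq (h : IsResolvent j ε S) (v : V) :
    ‖v‖ ^ 2 = ‖j.adjoint (j (S v))‖ ^ 2 + 2 * ε * ‖j (S v)‖ ^ 2 + ‖ε • S v‖ ^ 2 := by
  conv_lhs => rw [← h.right_inv v]
  rw [norm_add_sq_real, inner_smul_right, ContinuousLinearMap.adjoint_inner_left,
    real_inner_self_eq_norm_sq]
  ring

lemma norm_adjoint_le (h : IsResolvent j ε S) (hε : 0 < ε) (v : V) :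
    ‖S (j.adjoint (j v))‖ ≤ ‖v‖ := by
  rw [h.comm]
  refine (sq_le_sq₀ (norm_nonneg _) (norm_nonneg _)).mp ?_
  rw [h.norm_sq_eq v]
  have := sq_nonneg ‖ε • S v‖
  have : 0 ≤ 2 * ε * ‖j (S v)‖ ^ 2 := by positivity
  linarith

lemma norm_apply_adjoint_le (h : IsResolvent j ε S) (hε : 0 < ε) (x : H) :
    ‖j (S (j.adjoint x))‖ ≤ ‖x‖ := by
  set y := S (j.adjoint x)
  have h1 : ‖j y‖ ^ 2 + ε * ‖y‖ ^ 2 = ⟪x, j y⟫_ℝ := by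
    rw [← ContinuousLinearMap.adjoint_inner_left, ← h.right_inv (j.adjoint x), inner_add_left,
      ContinuousLinearMap.adjoint_inner_left, inner_smul_left, real_inner_self_eq_norm_sq,
      real_inner_self_eq_norm_sq]
    rfl
  have h2 := real_inner_le_norm x (j y)
  have h3 : 0 ≤ ε * ‖y‖ ^ 2 := by positivity
  rcases (norm_nonneg (j y)).eq_or_lt with h0 | hpos
  · rw [← h0]; exact norm_nonneg _
  · nlinarith

/-- `(j†j + ε)⁻¹ j†j - 1 = -ε (j†j + ε)⁻¹`. -/
lemma apply_adjoint_sub (h : IsResolvent j ε S) (v : V) :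
    S (j.adjoint (j v)) - v = -(ε • S v) := by
  have := h.left_inv v
  rw [map_add, map_smul] at this
  rw [eq_neg_iff_add_eq_zero, sub_add_eq_add_sub, this, sub_self]

end IsResolvent

lemma denseRange_adjoint_comp_self {j : V →L[ℝ] H} (hj : Function.Injective j) :
    DenseRange fun v => j.adjoint (j v) := by
  set B : V →L[ℝ] V := j.adjoint.comp j
  have hB : B.rangeᗮ = ⊥ := by
    rw [Submodule.eq_bot_iff]
    intro v hv
    have h1 : ⟪B v, v⟫_ℝ = 0 := hv _ ⟨v, rfl⟩
    change ⟪j.adjoint (j v), v⟫_ℝ = 0 at h1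
    rw [ContinuousLinearMap.adjoint_inner_left, inner_self_eq_zero] at h1
    exact hj (by rw [h1, map_zero])
  have h2 := Submodule.topologicalClosure_eq_top_iff.mpr hB
  exact (Submodule.dense_iff_topologicalClosure_eq_top.mpr h2)

variable {j : V →L[ℝ] H} {ε : ℕ → ℝ} {S : ℕ → V →L[ℝ] V}

lemma tendsto_resolvent_adjoint_sub (hS : ∀ n, IsResolvent j (ε n) (S n)) (hε : ∀ n, 0 < ε n)
    (hε0 : Tendsto ε atTop (𝓝 0)) (hj : Function.Injective j) (v : V) :
    Tendsto (fun n => S n (j.adjoint (j v)) - v) atTop (𝓝 0) := by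
  set Q : ℕ → V →L[ℝ] V := fun n => (S n).comp (j.adjoint.comp j) - ContinuousLinearMap.id ℝ V
  have hQ : ∀ n v, Q n v = S n (j.adjoint (j v)) - v := fun n v => rfl
  simp only [← hQ]
  refine tendsto_zero_of_denseRange (C := 2) (fun n v => ?_) (denseRange_adjoint_comp_self hj)
    (fun z => ?_) v
  · rw [hQ]
    refine (norm_sub_le _ _).trans ?_
    linarith [(hS n).norm_adjoint_le (hε n) v]
  · refine squeeze_zero_norm (a := fun n => ε n * ‖z‖) (fun n => ?_)
      (by simpa using hε0.mul_const ‖z‖)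
    rw [hQ, (hS n).apply_adjoint_sub, norm_neg, norm_smul, Real.norm_of_nonneg (hε n).le]
    exact mul_le_mul_of_nonneg_left ((hS n).norm_adjoint_le (hε n) z) (hε n).le

lemma tendsto_apply_resolvent_adjoint_sub (hS : ∀ n, IsResolvent j (ε n) (S n))
    (hε : ∀ n, 0 < ε n) (hε0 : Tendsto ε atTop (𝓝 0)) (hj : Function.Injective j)
    (hd : DenseRange j) (x : H) :
    Tendsto (fun n => j (S n (j.adjoint x)) - x) atTop (𝓝 0) := by
  set Q : ℕ → H →L[ℝ] H :=
    fun n => j.comp ((S n).comp j.adjoint) - ContinuousLinearMap.id ℝ H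
  have hQ : ∀ n v, Q n v = j (S n (j.adjoint v)) - v := fun n v => rfl
  simp only [← hQ]
  refine tendsto_zero_of_denseRange (C := 2) (fun n v => ?_) hd (fun z => ?_) x
  · rw [hQ]
    refine (norm_sub_le _ _).trans ?_
    linarith [(hS n).norm_apply_adjoint_le (hε n) v]
  · simp only [hQ, ← map_sub]
    have h0 := (j.continuous.tendsto 0).comp (tendsto_resolvent_adjoint_sub hS hε hε0 hj z)
    rwa [map_zero] at h0

end Resolvent

end

/-! ### The Lions–Magenes lemma -/

section

open Filter Topology

lemma timeMeasure_eq_restrict_Ioc (T : ℝ) : timeMeasure T = volume.restrict (Set.Ioc 0 T) :=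
  Measure.restrict_congr_set Ioo_ae_eq_Ioc

instance (T : ℝ) : IsFiniteMeasure (timeMeasure T) := by
  unfold timeMeasure
  infer_instance

variable {X : Type*} [NormedAddCommGroup X]

lemma MeasureTheory.Integrable.intervalIntegrable_of_timeMeasure {T : ℝ} {k : ℝ → X}
    (hk : Integrable k (timeMeasure T)) {t : ℝ} (ht : t ∈ Set.Icc 0 T) :
    IntervalIntegrable k volume 0 t := by
  rw [intervalIntegrable_iff_integrableOn_Ioc_of_le ht.1]
  rw [timeMeasure_eq_restrict_Ioc] at hk
  exact IntegrableOn.mono_set hk (Set.Ioc_subset_Ioc_right ht.2)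

lemma intervalIntegral_le_integral_timeMeasure {T t : ℝ} (ht : t ∈ Set.Icc 0 T) {φ ψ : ℝ → ℝ}
    (hψ : Integrable ψ (timeMeasure T)) (h0 : ∀ s, 0 ≤ ψ s)
    (h : ∀ᵐ s ∂(timeMeasure T), φ s ≤ ψ s) :
    ∫ s in (0 : ℝ)..t, φ s ≤ ∫ s, ψ s ∂(timeMeasure T) := by
  rw [timeMeasure_eq_restrict_Ioc] at *
  have hsub : Set.Ioc 0 t ⊆ Set.Ioc 0 T := Set.Ioc_subset_Ioc_right ht.2
  rw [intervalIntegral.integral_of_le ht.1]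
  have hψt : IntegrableOn ψ (Set.Ioc 0 t) := IntegrableOn.mono_set hψ hsub
  have h1 : ∫ s in Set.Ioc 0 t, φ s ≤ ∫ s in Set.Ioc 0 t, ψ s := by
    have h' := ae_restrict_of_ae_restrict_of_subset hsub h
    by_cases hφ : IntegrableOn φ (Set.Ioc 0 t)
    · exact integral_mono_ae hφ hψt h'
    · rw [integral_undef hφ]
      exact integral_nonneg h0
  exact h1.trans (setIntegral_mono_set hψ (ae_of_all _ h0) hsub.eventuallyLE)

variable {V H : Type*} [NormedAddCommGroup V] [InnerProductSpace ℝ V] [CompleteSpace V]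
  [NormedAddCommGroup H] [InnerProductSpace ℝ H] [CompleteSpace H]
  {j : V →L[ℝ] H} {ε : ℕ → ℝ} {S : ℕ → V →L[ℝ] V}

lemma integrable_norm_sq_resolvent (S : V →L[ℝ] V) {T : ℝ} {u : ℝ → V}
    (hu : MemLp u 2 (timeMeasure T)) :
    Integrable (fun t => ‖S (j.adjoint (j (u t))) - u t‖ ^ 2) (timeMeasure T) := by
  set Q : V →L[ℝ] V := S.comp (j.adjoint.comp j) - ContinuousLinearMap.id ℝ V
  exact (Q.comp_memLp' hu).integrable_norm_pow two_ne_zero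

lemma tendsto_integral_norm_sq_resolvent (hS : ∀ n, IsResolvent j (ε n) (S n))
    (hε : ∀ n, 0 < ε n) (hε0 : Tendsto ε atTop (𝓝 0)) (hj : Function.Injective j) {T : ℝ}
    {u : ℝ → V} (hu : MemLp u 2 (timeMeasure T)) :
    Tendsto (fun n => ∫ t, ‖S n (j.adjoint (j (u t))) - u t‖ ^ 2 ∂(timeMeasure T)) atTop
      (𝓝 0) := by
  have hint : Integrable (fun t => 4 * ‖u t‖ ^ 2) (timeMeasure T) :=
    (hu.integrable_norm_pow two_ne_zero).const_mul 4
  have := tendsto_integral_of_dominated_convergence (μ := timeMeasure T)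
    (F := fun n t => ‖S n (j.adjoint (j (u t))) - u t‖ ^ 2) (f := fun _ => (0 : ℝ)) _
    (fun n => (integrable_norm_sq_resolvent (S n) hu).aestronglyMeasurable) hint
    (fun n => ae_of_all _ fun t => ?_) (ae_of_all _ fun t => ?_)
  · simpa using this
  · rw [Real.norm_of_nonneg (sq_nonneg _)]
    have h1 : ‖S n (j.adjoint (j (u t))) - u t‖ ≤ 2 * ‖u t‖ :=
      (norm_sub_le _ _).trans (by linarith [(hS n).norm_adjoint_le (hε n) (u t)])
    calc ‖S n (j.adjoint (j (u t))) - u t‖ ^ 2 ≤ (2 * ‖u t‖) ^ 2 :=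
          pow_le_pow_left₀ (norm_nonneg _) h1 2
      _ = 4 * ‖u t‖ ^ 2 := by ring
  · have h := (tendsto_resolvent_adjoint_sub hS hε hε0 hj (u t)).norm.pow 2
    simpa using h

lemma norm_sub_sq_le_two_mul {E : Type*} [NormedAddCommGroup E] (a b : E) :
    ‖a - b‖ ^ 2 ≤ 2 * ‖a‖ ^ 2 + 2 * ‖b‖ ^ 2 := by
  have h1 := norm_sub_le a b
  have h2 : ‖a - b‖ ^ 2 ≤ (‖a‖ + ‖b‖) ^ 2 := pow_le_pow_left₀ (norm_nonneg _) h1 2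
  nlinarith [sq_nonneg (‖a‖ - ‖b‖)]

/-- The energy estimate for the difference of two regularizations of `j†c + ∫ g`. -/
lemma norm_sq_resolvent_sub_le {S₁ S₂ : V →L[ℝ] V} {ε₁ ε₂ : ℝ} (h₁ : IsResolvent j ε₁ S₁)
    (h₂ : IsResolvent j ε₂ S₂) {T : ℝ} {u g : ℝ → V} (hu : MemLp u 2 (timeMeasure T))
    (hg : MemLp g 2 (timeMeasure T)) {c : H}
    (heq : ∀ᵐ t ∂(timeMeasure T), j.adjoint (j (u t)) = j.adjoint c + ∫ s in (0 : ℝ)..t, g s)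
    {t : ℝ} (ht : t ∈ Set.Icc 0 T) :
    ‖j (S₁ (j.adjoint c + ∫ s in (0 : ℝ)..t, g s)) -
        j (S₂ (j.adjoint c + ∫ s in (0 : ℝ)..t, g s))‖ ^ 2 ≤
      (2 * ‖j (S₁ (j.adjoint c)) - c‖ ^ 2 +
        2 * ((∫ s, ‖S₁ (j.adjoint (j (u s))) - u s‖ ^ 2 ∂(timeMeasure T)) +
          ∫ s, ‖S₁ (j.adjoint (j (g s))) - g s‖ ^ 2 ∂(timeMeasure T))) +
      (2 * ‖j (S₂ (j.adjoint c)) - c‖ ^ 2 +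
        2 * ((∫ s, ‖S₂ (j.adjoint (j (u s))) - u s‖ ^ 2 ∂(timeMeasure T)) +
          ∫ s, ‖S₂ (j.adjoint (j (g s))) - g s‖ ^ 2 ∂(timeMeasure T))) := by
  set D : V →L[ℝ] V := S₁ - S₂ with hD
  have hDa : ∀ v, D v = S₁ v - S₂ v := fun v => rfl
  set L : V →L[ℝ] H := j.comp D
  have hL : ∀ v, L v = j (D v) := fun v => rfl
  have hgI : ∀ {s}, s ∈ Set.Icc 0 T → IntervalIntegrable g volume 0 s := fun hs =>
    (hg.integrable one_le_two).intervalIntegrable_of_timeMeasure hs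
  have hprim : ∀ s ∈ Set.Icc 0 T, L (j.adjoint c) + ∫ r in (0 : ℝ)..s, L (g r) =
      L (j.adjoint c + ∫ r in (0 : ℝ)..s, g r) := by
    intro s hs
    rw [map_add, L.intervalIntegral_comp_comm (hgI hs)]
  have hLg : IntervalIntegrable (fun s => L (g s)) volume 0 t :=
    ⟨L.integrable_comp (hgI ht).1, L.integrable_comp (hgI ht).2⟩
  have hen := norm_sq_add_integral hLg (L (j.adjoint c))
  rw [hprim t ht] at hen
  rw [← map_sub, ← hDa, ← hL, hen]
  have hc : ‖L (j.adjoint c)‖ ^ 2 ≤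
      2 * ‖j (S₁ (j.adjoint c)) - c‖ ^ 2 + 2 * ‖j (S₂ (j.adjoint c)) - c‖ ^ 2 := by
    refine le_trans (le_of_eq ?_) (norm_sub_sq_le_two_mul _ _)
    rw [hL, hDa, map_sub]
    congr 2
    abel
  set ψ : ℝ → ℝ := fun s => 2 * (‖S₁ (j.adjoint (j (u s))) - u s‖ ^ 2 +
    ‖S₁ (j.adjoint (j (g s))) - g s‖ ^ 2) + 2 * (‖S₂ (j.adjoint (j (u s))) - u s‖ ^ 2 +
    ‖S₂ (j.adjoint (j (g s))) - g s‖ ^ 2) with hψ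
  have i1 := integrable_norm_sq_resolvent (j := j) S₁ hu
  have i2 := integrable_norm_sq_resolvent (j := j) S₁ hg
  have i3 := integrable_norm_sq_resolvent (j := j) S₂ hu
  have i4 := integrable_norm_sq_resolvent (j := j) S₂ hg
  have hψi : Integrable ψ (timeMeasure T) :=
    ((i1.add i2).const_mul 2).add ((i3.add i4).const_mul 2)
  have hψint : ∫ s, ψ s ∂(timeMeasure T) =
      2 * ((∫ s, ‖S₁ (j.adjoint (j (u s))) - u s‖ ^ 2 ∂(timeMeasure T)) +
          ∫ s, ‖S₁ (j.adjoint (j (g s))) - g s‖ ^ 2 ∂(timeMeasure T)) +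
      2 * ((∫ s, ‖S₂ (j.adjoint (j (u s))) - u s‖ ^ 2 ∂(timeMeasure T)) +
          ∫ s, ‖S₂ (j.adjoint (j (g s))) - g s‖ ^ 2 ∂(timeMeasure T)) := by
    rw [← integral_add i1 i2, ← integral_add i3 i4, ← integral_const_mul, ← integral_const_mul]
    exact integral_add ((i1.add i2).const_mul 2) ((i3.add i4).const_mul 2)
  have hmem : ∀ᵐ s ∂(timeMeasure T), s ∈ Set.Ioo 0 T := ae_restrict_mem measurableSet_Ioo
  have hle := intervalIntegral_le_integral_timeMeasure ht hψi (fun s => by positivity)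
    (φ := fun s => 2 * ⟪L (j.adjoint c) + ∫ r in (0 : ℝ)..s, L (g r), L (g s)⟫_ℝ) (by
      filter_upwards [heq, hmem] with s hs hsT
      rw [hprim s ⟨hsT.1.le, hsT.2.le⟩, ← hs]
      -- `j†j` commutes with the resolvents, so that the pairing takes place in `V`
      have hcomm : j.adjoint (L (g s)) = D (j.adjoint (j (g s))) := by
        rw [hL, hDa, hDa, map_sub, map_sub, h₁.comm, h₂.comm]
      have hinner : ⟪L (j.adjoint (j (u s))), L (g s)⟫_ℝ =
          ⟪D (j.adjoint (j (u s))), D (j.adjoint (j (g s)))⟫_ℝ := by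
        rw [← hcomm, ContinuousLinearMap.adjoint_inner_right, hL]
      rw [hinner]
      have hsplit : ∀ v : V, D (j.adjoint (j v)) =
          (S₁ (j.adjoint (j v)) - v) - (S₂ (j.adjoint (j v)) - v) := fun v => by
        rw [hDa]; abel
      have e1 := norm_sub_sq_le_two_mul (S₁ (j.adjoint (j (u s))) - u s)
        (S₂ (j.adjoint (j (u s))) - u s)
      have e2 := norm_sub_sq_le_two_mul (S₁ (j.adjoint (j (g s))) - g s)
        (S₂ (j.adjoint (j (g s))) - g s)
      rw [← hsplit] at e1 e2
      have e3 := real_inner_le_norm (D (j.adjoint (j (u s)))) (D (j.adjoint (j (g s))))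
      have e4 := two_mul_le_add_sq ‖D (j.adjoint (j (u s)))‖ ‖D (j.adjoint (j (g s)))‖
      simp only [hψ]
      linarith)
  rw [hψint] at hle
  linarith

/-- The Lions–Magenes lemma, with the dual of `V` identified with `V`: if `u` and `g` are square
integrable in `V` and `(j†j u)' = g`, with an initial value in the range of `j†`, then `j u` has
a continuous modification. -/
lemma exists_continuousOn_of_adjoint_eq_integral (hj : Function.Injective j) (hd : DenseRange j)
    {T : ℝ} {u g : ℝ → V} (hu : MemLp u 2 (timeMeasure T)) (hg : MemLp g 2 (timeMeasure T)) {c : H}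
    (heq : ∀ᵐ t ∂(timeMeasure T), j.adjoint (j (u t)) = j.adjoint c + ∫ s in (0 : ℝ)..t, g s) :
    ∃ w : ℝ → H, ContinuousOn w (Set.Icc 0 T) ∧ ∀ᵐ t ∂(timeMeasure T), j (u t) = w t := by
  set ε : ℕ → ℝ := fun n => 1 / ((n : ℝ) + 1)
  have hε : ∀ n, 0 < ε n := fun n => Nat.one_div_pos_of_nat
  have hε0 : Tendsto ε atTop (𝓝 0) := tendsto_one_div_add_atTop_nhds_zero_nat
  choose S hS using fun n => exists_isResolvent j (hε n)
  -- the regularizations `y n` of `j u` satisfy `‖y n - y m‖² ≤ κ n + κ m` on `[0,T]`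
  set v : ℝ → V := fun t => j.adjoint c + ∫ s in (0 : ℝ)..t, g s
  set y : ℕ → ℝ → H := fun n t => j (S n (v t))
  set κ : ℕ → ℝ := fun n => 2 * ‖j (S n (j.adjoint c)) - c‖ ^ 2 +
    2 * ((∫ s, ‖S n (j.adjoint (j (u s))) - u s‖ ^ 2 ∂(timeMeasure T)) +
      ∫ s, ‖S n (j.adjoint (j (g s))) - g s‖ ^ 2 ∂(timeMeasure T))
  have hκ : Tendsto κ atTop (𝓝 0) := by
    have h1 := ((tendsto_apply_resolvent_adjoint_sub hS hε hε0 hj hd c).norm.pow 2).const_mul 2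
    have h2 := ((tendsto_integral_norm_sq_resolvent hS hε hε0 hj hu).add
      (tendsto_integral_norm_sq_resolvent hS hε hε0 hj hg)).const_mul 2
    simpa using h1.add h2
  have hest : ∀ n m, ∀ t ∈ Set.Icc 0 T, ‖y n t - y m t‖ ^ 2 ≤ κ n + κ m := fun n m t ht =>
    norm_sq_resolvent_sub_le (hS n) (hS m) hu hg heq ht
  have hcau : UniformCauchySeqOn y atTop (Set.Icc 0 T) := by
    rw [Metric.uniformCauchySeqOn_iff]
    intro η hη
    obtain ⟨N, hN⟩ := Metric.tendsto_atTop.mp hκ (η ^ 2 / 2) (by positivity)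
    refine ⟨N, fun m hm n hn t ht => ?_⟩
    have h1 := hN m hm
    have h2 := hN n hn
    rw [Real.dist_eq, sub_zero] at h1 h2
    rw [dist_eq_norm]
    refine lt_of_pow_lt_pow_left₀ 2 hη.le ((hest m n t ht).trans_lt ?_)
    linarith [le_abs_self (κ m), le_abs_self (κ n)]
  have hlim : ∀ t, ∃ w, t ∈ Set.Icc 0 T → Tendsto (fun n => y n t) atTop (𝓝 w) := by
    intro t
    by_cases ht : t ∈ Set.Icc 0 T
    · obtain ⟨w, hw⟩ := cauchySeq_tendsto_of_complete (hcau.cauchySeq ht)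
      exact ⟨w, fun _ => hw⟩
    · exact ⟨0, fun h => absurd h ht⟩
  choose w hw using hlim
  refine ⟨w, ?_, ?_⟩
  · refine (hcau.tendstoUniformlyOn_of_tendsto fun t ht => hw t ht).continuousOn
      (Frequently.of_forall fun n => ?_)
    rcases lt_or_ge T 0 with hT | hT
    · simp [Set.Icc_eq_empty_of_lt hT]
    have hgI := (hg.integrable one_le_two).intervalIntegrable_of_timeMeasure
      (Set.right_mem_Icc.mpr hT)
    have := intervalIntegral.continuousOn_primitive_interval' hgI Set.left_mem_uIcc
    rw [Set.uIcc_of_le hT] at this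
    exact (j.continuous.comp (S n).continuous).comp_continuousOn (continuousOn_const.add this)
  · have hmem : ∀ᵐ s ∂(timeMeasure T), s ∈ Set.Ioo 0 T := ae_restrict_mem measurableSet_Ioo
    filter_upwards [heq, hmem] with t ht htT
    refine tendsto_nhds_unique ?_ (hw t ⟨htT.1.le, htT.2.le⟩)
    have h1 := (tendsto_resolvent_adjoint_sub hS hε hε0 hj (u t)).add_const (u t)
    simp only [sub_add_cancel, zero_add] at h1
    have h2 := (j.continuous.tendsto _).comp h1
    rw [ht] at h2
    exact h2

end

/-! ### Operators between `L²` spaces -/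

section

open Filter Topology

variable {V X : Type*} [NormedAddCommGroup V] [NormedSpace ℝ V]
  [NormedAddCommGroup X] [NormedSpace ℝ X]

lemma exists_seq_tendsto_ae_of_tendsto_Lp {α X : Type*} [NormedAddCommGroup X]
    [MeasurableSpace α] {μ : Measure α}
    {u : ℕ → Lp X 2 μ} {x : Lp X 2 μ} (h : Tendsto u atTop (𝓝 x)) :
    ∃ ns : ℕ → ℕ, StrictMono ns ∧ ∀ᵐ t ∂μ, Tendsto (fun n => u (ns n) t) atTop (𝓝 (x t)) :=
  (tendstoInMeasure_of_tendsto_Lp h).exists_seq_tendsto_ae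

/-- A form of the closed graph theorem: a linear operator between `L²` spaces is bounded if, along
a subsequence of every convergent sequence, its values converge almost everywhere to the right
limit. -/
lemma continuous_of_exists_seq_tendsto_ae [CompleteSpace V] [CompleteSpace X] {α : Type*}
    [MeasurableSpace α] {μ : Measure α} (Φ : Lp V 2 μ →ₗ[ℝ] Lp X 2 μ)
    (h : ∀ (u : ℕ → Lp V 2 μ) (x : Lp V 2 μ), Tendsto u atTop (𝓝 x) →
      ∃ ns : ℕ → ℕ, StrictMono ns ∧
        ∀ᵐ t ∂μ, Tendsto (fun n => Φ (u (ns n)) t) atTop (𝓝 (Φ x t))) :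
    Continuous Φ := by
  refine Φ.continuous_of_seq_closed_graph fun u x y hu hy => ?_
  obtain ⟨ns, hns, hae⟩ := h u x hu
  obtain ⟨ms, hms, hae'⟩ := exists_seq_tendsto_ae_of_tendsto_Lp (hy.comp hns.tendsto_atTop)
  refine Lp.ext ?_
  filter_upwards [hae, hae'] with t h1 h2
  exact tendsto_nhds_unique h2 (h1.comp hms.tendsto_atTop)

section Family

variable {α : Type*} [MeasurableSpace α] {μ : Measure α}

/-- The linear map underlying `familyLp`. -/
noncomputable def familyLpLinear (B : α → V →L[ℝ] X)
    (hB : ∀ v : Lp V 2 μ, MemLp (fun t => B t (v t)) 2 μ) : Lp V 2 μ →ₗ[ℝ] Lp X 2 μ where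
  toFun v := (hB v).toLp
  map_add' v w := by
    refine Lp.ext ?_
    filter_upwards [(hB (v + w)).coeFn_toLp, (hB v).coeFn_toLp, (hB w).coeFn_toLp,
      Lp.coeFn_add v w, Lp.coeFn_add (hB v).toLp (hB w).toLp] with t h1 h2 h3 h4 h5
    rw [h1, h5, Pi.add_apply, h2, h3, h4, Pi.add_apply, map_add]
  map_smul' c v := by
    refine Lp.ext ?_
    filter_upwards [(hB (c • v)).coeFn_toLp, (hB v).coeFn_toLp,
      Lp.coeFn_smul c v, Lp.coeFn_smul c (hB v).toLp] with t h1 h2 h3 h4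
    rw [h1, RingHom.id_apply, h4, Pi.smul_apply, h2, h3, Pi.smul_apply, map_smul]

lemma coeFn_familyLpLinear (B : α → V →L[ℝ] X)
    (hB : ∀ v : Lp V 2 μ, MemLp (fun t => B t (v t)) 2 μ) (v : Lp V 2 μ) :
    familyLpLinear B hB v =ᵐ[μ] fun t => B t (v t) :=
  (hB v).coeFn_toLp

variable [CompleteSpace V] [CompleteSpace X]

/-- The bounded operator `v ↦ (t ↦ B(t) v(t))` between `L²` spaces that is given by a family of
bounded operators `B(t)` which maps square integrable functions to square integrable ones. It is
bounded by the closed graph theorem. -/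
noncomputable def familyLp (B : α → V →L[ℝ] X)
    (hB : ∀ v : Lp V 2 μ, MemLp (fun t => B t (v t)) 2 μ) : Lp V 2 μ →L[ℝ] Lp X 2 μ where
  toLinearMap := familyLpLinear B hB
  cont := by
    refine continuous_of_exists_seq_tendsto_ae _ fun u x hu => ?_
    obtain ⟨ns, hns, hae⟩ := exists_seq_tendsto_ae_of_tendsto_Lp hu
    refine ⟨ns, hns, ?_⟩
    filter_upwards [hae, coeFn_familyLpLinear B hB x,
      ae_all_iff.mpr fun n => coeFn_familyLpLinear B hB (u n)] with t h1 h2 h3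
    simp only [h2, h3]
    exact ((B t).continuous.tendsto _).comp h1

lemma coeFn_familyLp (B : α → V →L[ℝ] X)
    (hB : ∀ v : Lp V 2 μ, MemLp (fun t => B t (v t)) 2 μ) (v : Lp V 2 μ) :
    familyLp B hB v =ᵐ[μ] fun t => B t (v t) :=
  coeFn_familyLpLinear B hB v

end Family

section Volterra

lemma memLp_integral_timeMeasure {T : ℝ} {g : ℝ → X} (hg : Integrable g (timeMeasure T)) :
    MemLp (fun t => ∫ s in (0 : ℝ)..t, g s) 2 (timeMeasure T) := by
  rcases lt_or_ge T 0 with hT | hT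
  · have : timeMeasure T = 0 := by simp [timeMeasure, Set.Ioo_eq_empty_of_le hT.le]
    rw [this]
    exact memLp_measure_zero
  have hc := intervalIntegral.continuousOn_primitive_interval'
    (hg.intervalIntegrable_of_timeMeasure (Set.right_mem_Icc.mpr hT)) Set.left_mem_uIcc
  rw [Set.uIcc_of_le hT] at hc
  obtain ⟨C, hC⟩ := isCompact_Icc.exists_bound_of_continuousOn hc
  refine MemLp.of_bound ((hc.mono Set.Ioo_subset_Icc_self).aestronglyMeasurable measurableSet_Ioo)
    C ?_
  filter_upwards [ae_restrict_mem measurableSet_Ioo] with t ht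
  exact hC t (Set.Ioo_subset_Icc_self ht)

lemma integrable_timeL2 {X : Type*} [NormedAddCommGroup X] {T : ℝ} (g : TimeL2 T X) : Integrable g (timeMeasure T) :=
  (Lp.memLp g).integrable one_le_two

lemma intervalIntegral_congr_timeMeasure {T t : ℝ} (ht : t ∈ Set.Icc 0 T) {g k : ℝ → X}
    (h : g =ᵐ[timeMeasure T] k) : ∫ s in (0 : ℝ)..t, g s = ∫ s in (0 : ℝ)..t, k s := by
  rw [intervalIntegral.integral_of_le ht.1, intervalIntegral.integral_of_le ht.1]
  rw [timeMeasure_eq_restrict_Ioc] at h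
  exact integral_congr_ae
    (ae_restrict_of_ae_restrict_of_subset (Set.Ioc_subset_Ioc_right ht.2) h)

lemma ae_mem_Icc_timeMeasure (T : ℝ) : ∀ᵐ t ∂(timeMeasure T), t ∈ Set.Icc 0 T := by
  filter_upwards [ae_restrict_mem measurableSet_Ioo] with t ht
  exact Set.Ioo_subset_Icc_self ht

lemma tendsto_integral_of_tendsto_timeL2 {T t : ℝ} (ht : t ∈ Set.Icc 0 T)
    {g : ℕ → TimeL2 T X} {k : TimeL2 T X} (h : Tendsto g atTop (𝓝 k)) :
    Tendsto (fun n => ∫ s in (0 : ℝ)..t, g n s) atTop (𝓝 (∫ s in (0 : ℝ)..t, k s)) := by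
  have hr : ∀ f : ℝ → X, ∫ s in (0 : ℝ)..t, f s = ∫ s in Set.Ioc 0 t, f s ∂(timeMeasure T) := by
    intro f
    rw [timeMeasure_eq_restrict_Ioc, Measure.restrict_restrict measurableSet_Ioc,
      Set.inter_eq_left.mpr (Set.Ioc_subset_Ioc_right ht.2), intervalIntegral.integral_of_le ht.1]
  simp only [hr]
  refine tendsto_setIntegral_of_L1' _ (integrable_timeL2 k).aestronglyMeasurable
    (Eventually.of_forall fun n => integrable_timeL2 (g n)) ?_ _
  have h2 := (Lp.tendsto_Lp_iff_tendsto_eLpNorm' g k).mp h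
  have h3 := ENNReal.Tendsto.mul_const (b := timeMeasure T Set.univ ^
    (1 / (1 : ENNReal).toReal - 1 / (2 : ENNReal).toReal)) h2
    (Or.inr (ENNReal.rpow_ne_top_of_nonneg (by norm_num) (measure_ne_top _ _)))
  rw [zero_mul] at h3
  exact tendsto_of_tendsto_of_tendsto_of_le_of_le tendsto_const_nhds h3 (fun _ => zero_le)
    fun n => eLpNorm_le_eLpNorm_mul_rpow_measure_univ one_le_two
      ((integrable_timeL2 (g n)).sub (integrable_timeL2 k)).aestronglyMeasurable

/-- The linear map underlying `volterra`. -/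
noncomputable def volterraLinear (T : ℝ) : TimeL2 T X →ₗ[ℝ] TimeL2 T X where
  toFun g := (memLp_integral_timeMeasure (integrable_timeL2 g)).toLp
  map_add' g k := by
    refine Lp.ext ?_
    filter_upwards [(memLp_integral_timeMeasure (integrable_timeL2 (g + k))).coeFn_toLp,
      (memLp_integral_timeMeasure (integrable_timeL2 g)).coeFn_toLp,
      (memLp_integral_timeMeasure (integrable_timeL2 k)).coeFn_toLp,
      Lp.coeFn_add (memLp_integral_timeMeasure (integrable_timeL2 g)).toLp
        (memLp_integral_timeMeasure (integrable_timeL2 k)).toLp, ae_mem_Icc_timeMeasure T]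
      with t h1 h2 h3 h4 ht
    rw [h1, h4, Pi.add_apply, h2, h3, intervalIntegral_congr_timeMeasure ht (Lp.coeFn_add g k)]
    exact intervalIntegral.integral_add
      ((integrable_timeL2 g).intervalIntegrable_of_timeMeasure ht)
      ((integrable_timeL2 k).intervalIntegrable_of_timeMeasure ht)
  map_smul' c g := by
    refine Lp.ext ?_
    filter_upwards [(memLp_integral_timeMeasure (integrable_timeL2 (c • g))).coeFn_toLp,
      (memLp_integral_timeMeasure (integrable_timeL2 g)).coeFn_toLp,
      Lp.coeFn_smul c (memLp_integral_timeMeasure (integrable_timeL2 g)).toLp,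
      ae_mem_Icc_timeMeasure T] with t h1 h2 h3 ht
    rw [h1, RingHom.id_apply, h3, Pi.smul_apply, h2,
      intervalIntegral_congr_timeMeasure ht (Lp.coeFn_smul c g)]
    exact intervalIntegral.integral_smul c _

lemma coeFn_volterraLinear {T : ℝ} (g : TimeL2 T X) :
    volterraLinear T g =ᵐ[timeMeasure T] fun t => ∫ s in (0 : ℝ)..t, g s :=
  (memLp_integral_timeMeasure (integrable_timeL2 g)).coeFn_toLp

variable [CompleteSpace X]

/-- The Volterra operator `g ↦ (t ↦ ∫₀ᵗ g ds)` on `L²((0,T);X)`. -/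
noncomputable def volterra (T : ℝ) : TimeL2 T X →L[ℝ] TimeL2 T X where
  toLinearMap := volterraLinear T
  cont := by
    refine continuous_of_exists_seq_tendsto_ae _ fun u x hu => ?_
    refine ⟨id, strictMono_id, ?_⟩
    filter_upwards [coeFn_volterraLinear x, ae_all_iff.mpr fun n => coeFn_volterraLinear (u n),
      ae_mem_Icc_timeMeasure T] with t h1 h2 ht
    simp only [id, h1, h2]
    exact tendsto_integral_of_tendsto_timeL2 ht hu

lemma coeFn_volterra {T : ℝ} (g : TimeL2 T X) {k : ℝ → X} (h : g =ᵐ[timeMeasure T] k) :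
    ∀ᵐ t ∂(timeMeasure T), volterra T g t = ∫ s in (0 : ℝ)..t, k s := by
  filter_upwards [coeFn_volterraLinear g, ae_mem_Icc_timeMeasure T] with t h1 ht
  rw [← intervalIntegral_congr_timeMeasure ht h]
  exact h1

/-- An integral equation in `L²((0,T);X)` as an identity between elements of this space. -/
lemma ae_eq_add_integral_iff {T : ℝ} (E : V →L[ℝ] X) (x : TimeL2 T V) (c : X) (g : TimeL2 T X)
    {k : ℝ → X} (h : g =ᵐ[timeMeasure T] k) :
    (∀ᵐ t ∂(timeMeasure T), E (x t) = c + ∫ s in (0 : ℝ)..t, k s) ↔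
      E.compLpL 2 (timeMeasure T) x = Lp.constL 2 (timeMeasure T) ℝ c + volterra T g := by
  rw [Lp.ext_iff]
  have hE := E.coeFn_compLpL (p := 2) x
  have hs := Lp.coeFn_add (Lp.constL 2 (timeMeasure T) ℝ c) (volterra T g)
  have hc : (Lp.constL 2 (timeMeasure T) ℝ c : ℝ → X) =ᵐ[timeMeasure T] Function.const ℝ c :=
    Lp.coeFn_const 2 (timeMeasure T) c
  have hv := coeFn_volterra g h
  constructor
  · intro h'
    filter_upwards [h', hE, hs, hc, hv] with t h1 h2 h3 h4 h5
    rw [h2, h3, Pi.add_apply, h4, h5, h1, Function.const_apply]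
  · intro h'
    filter_upwards [h', hE, hs, hc, hv] with t h1 h2 h3 h4 h5
    rw [← h2, h1, h3, Pi.add_apply, h4, h5, Function.const_apply]

end Volterra

end

section InnerU

variable {X U : Type*} [NormedAddCommGroup X] [InnerProductSpace ℝ X] [CompleteSpace X]
  [NormedAddCommGroup U] [InnerProductSpace ℝ U]

/-- The partial inner product `(z, h)_U` as a bounded bilinear map of `h` and `z`. -/
noncomputable def innerUL (X U : Type*) [NormedAddCommGroup X] [InnerProductSpace ℝ X]
    [CompleteSpace X] [NormedAddCommGroup U] [InnerProductSpace ℝ U] :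
    U →L[ℝ] HilbertTensor X U →L[ℝ] X :=
  LinearMap.mkContinuous
    { toFun := fun h => innerU h
      map_add' := fun g h => by simp [innerU]
      map_smul' := fun c h => by simp [innerU] }
    (‖(UniformSpace.Completion.toComplL (𝕜 := ℝ) (E := X ⊗[ℝ] U))‖ *
      ‖(TensorProduct.mkL ℝ X U).flip‖) (fun h => by
      simp only [LinearMap.coe_mk, AddHom.coe_mk, innerU]
      rw [LinearIsometryEquiv.norm_map, mul_assoc]
      exact (ContinuousLinearMap.opNorm_comp_le _ _).trans
        (mul_le_mul_of_nonneg_left (ContinuousLinearMap.le_opNorm _ _) (norm_nonneg _)))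

lemma innerUL_apply (h : U) : innerUL X U h = innerU h := rfl

end InnerU

/-! ### The defect of the propagator equation -/

section

open Filter Topology

variable {ι X Y U : Type*} [NormedAddCommGroup X] [NormedSpace ℝ X]
  [NormedAddCommGroup Y] [NormedSpace ℝ Y] [NormedAddCommGroup U] [InnerProductSpace ℝ U]

lemma expCoeff_add_single_mul_sqrt (s : ι → ℝ) (β : MultiIndex ι) (k : ι) :
    expCoeff s (β + Finsupp.single k 1) * √((β k + 1 : ℕ) : ℝ) = s k * expCoeff s β := by
  classical
  have hsub : (β + Finsupp.single k 1).support ⊆ insert k β.support := by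
    intro i hi
    by_cases hik : i = k
    · simp [hik]
    · simpa [Finsupp.single_apply, Ne.symm hik, hik] using hi
  rw [expCoeff_eq_prod s hsub, expCoeff_eq_prod s (Finset.subset_insert k β.support),
    ← Finset.mul_prod_erase _ _ (Finset.mem_insert_self k _),
    ← Finset.mul_prod_erase _ _ (Finset.mem_insert_self k _)]
  have hrest : ∀ i ∈ (insert k β.support).erase k,
      s i ^ (β + Finsupp.single k 1 : MultiIndex ι) i /
          √(((β + Finsupp.single k 1 : MultiIndex ι) i).factorial : ℝ) =
        s i ^ β i / √((β i).factorial : ℝ) := by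
    intro i hi
    have hik := Finset.ne_of_mem_erase hi
    simp [Ne.symm hik]
  rw [Finset.prod_congr rfl hrest]
  have hk : (β + Finsupp.single k 1 : MultiIndex ι) k = β k + 1 := by simp
  rw [hk, Nat.factorial_succ, Nat.cast_mul, Real.sqrt_mul (Nat.cast_nonneg _), pow_succ]
  have h1 : √((β k + 1 : ℕ) : ℝ) ≠ 0 := by positivity
  have h2 : √((β k).factorial : ℝ) ≠ 0 := by positivity
  field_simp

/-- The creation operator: multiplying a series with coefficients `u` by `(h, e_k)` shifts its
coefficients to `√(α_k) u_{α - ε_k}`. -/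
lemma hasSum_expCoeff_shift {s : ι → ℝ} {u : MultiIndex ι → X} {x : X}
    (h : HasSum (fun α => expCoeff s α • u α) x) (N : X →L[ℝ] Y) (k : ι) :
    HasSum (fun α => expCoeff s α • (√(α k : ℝ) • N (u (α - Finsupp.single k 1)))) (s k • N x) := by
  have hinj : Function.Injective fun β : MultiIndex ι => β + Finsupp.single k 1 :=
    fun _ _ hβ => add_right_cancel hβ
  rw [← hinj.hasSum_iff]
  · have h1 := (h.mapL N).const_smul (s k)
    convert! h1 using 1
    ext β
    have hk : (β + Finsupp.single k 1 : MultiIndex ι) k = β k + 1 := by simp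
    simp only [Function.comp_apply, hk, add_tsub_cancel_right, map_smul, smul_smul,
      expCoeff_add_single_mul_sqrt]
  · intro α hα
    by_cases hk : α k = 0
    · simp [hk]
    · refine absurd ⟨α - Finsupp.single k 1, ?_⟩ hα
      exact tsub_add_cancel_of_le
        (Finsupp.single_le_iff.mpr (Nat.one_le_iff_ne_zero.mpr hk))

/-- The defect of the propagator equation `L u_α = g_α + ∑ₖ √(α_k) N(e_k) u_{α - ε_k}`. -/
noncomputable def propagatorDefect (L : X →L[ℝ] Y) (N : U →L[ℝ] X →L[ℝ] Y) (e : ι → U)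
    (g : MultiIndex ι → Y) (u : MultiIndex ι → X) (α : MultiIndex ι) : Y :=
  L (u α) - g α - α.sum fun k n => √(n : ℝ) • N (e k) (u (α - Finsupp.single k 1))

/-- For `h` in the span of finitely many basis vectors, the defect of the equation for the chaos
pairing with `ℰ_h` is the pairing of the defects of the propagator equations. -/
lemma hasSum_expCoeff_propagatorDefect {L : X →L[ℝ] Y} {N : U →L[ℝ] X →L[ℝ] Y} {e : ι → U}
    {g : MultiIndex ι → Y} {u : MultiIndex ι → X} {s : ι → ℝ} {F : Finset ι}
    (hs : ∀ k ∉ F, s k = 0) {x : X} {y : Y} (hu : HasSum (fun α => expCoeff s α • u α) x)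
    (hg : HasSum (fun α => expCoeff s α • g α) y) :
    HasSum (fun α => expCoeff s α • propagatorDefect L N e g u α)
      (L x - y - N (∑ k ∈ F, s k • e k) x) := by
  have h1 := (hu.mapL L).sub hg
  have h2 := hasSum_sum (s := F) fun k _ => hasSum_expCoeff_shift hu (N (e k)) k
  have h3 := h1.sub h2
  have hN : N (∑ k ∈ F, s k • e k) x = ∑ k ∈ F, s k • N (e k) x := by
    simp
  rw [hN]
  convert! h3 using 1
  ext α
  by_cases hα : α.support ⊆ F
  · rw [propagatorDefect, Finsupp.sum_of_support_subset _ hα _ (by simp), smul_sub, smul_sub,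
      map_smul, Finset.smul_sum]
  · simp [expCoeff_eq_zero hs hα]

variable [CompleteSpace X] [CompleteSpace Y]

lemma abs_expCoeff_indicator_le (s : ι → ℝ) (F : Finset ι) (α : MultiIndex ι) :
    |expCoeff (Set.indicator (F : Set ι) s) α| ≤ |expCoeff s α| := by
  by_cases hα : α.support ⊆ F
  · refine le_of_eq ?_
    rw [expCoeff_eq_prod s hα, expCoeff_eq_prod _ hα]
    congr 1
    refine Finset.prod_congr rfl fun k hk => ?_
    rw [Set.indicator_of_mem (Finset.mem_coe.mpr hk)]
  · rw [expCoeff_eq_zero (F := F) (fun k hk => Set.indicator_of_notMem (by simpa using hk) s) hα,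
      abs_zero]
    exact abs_nonneg _

lemma tendsto_tsum_expCoeff_indicator {s : ι → ℝ} {u : MultiIndex ι → X}
    (hu : Summable fun α => |expCoeff s α| * ‖u α‖) :
    Tendsto (fun F : Finset ι => ∑' α, expCoeff (Set.indicator (F : Set ι) s) α • u α) atTop
      (𝓝 (∑' α, expCoeff s α • u α)) := by
  refine tendsto_tsum_of_dominated_convergence hu (fun α => ?_)
    (Eventually.of_forall fun F α => ?_)
  · refine tendsto_const_nhds.congr' ?_
    filter_upwards [eventually_ge_atTop α.support] with F hF
    rw [expCoeff_eq_prod s hF, expCoeff_eq_prod _ hF]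
    congr 1
    refine Finset.prod_congr rfl fun k hk => ?_
    rw [Set.indicator_of_mem (Finset.mem_coe.mpr hk)]
  · rw [norm_smul, Real.norm_eq_abs]
    exact mul_le_mul_of_nonneg_right (abs_expCoeff_indicator_le s F α) (norm_nonneg _)

lemma summable_expCoeff_smul {s : ι → ℝ} {u : MultiIndex ι → X}
    (hu : Summable fun α => |expCoeff s α| * ‖u α‖) : Summable fun α => expCoeff s α • u α :=
  Summable.of_norm (by simpa [norm_smul] using hu)

lemma summable_expCoeff_indicator_smul {s : ι → ℝ} {u : MultiIndex ι → X} (F : Finset ι)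
    (hu : Summable fun α => |expCoeff s α| * ‖u α‖) :
    Summable fun α => expCoeff (Set.indicator (F : Set ι) s) α • u α :=
  summable_expCoeff_smul (hu.of_nonneg_of_le (fun _ => by positivity) fun α =>
    mul_le_mul_of_nonneg_right (abs_expCoeff_indicator_le s F α) (norm_nonneg _))

/-- The propagator equations imply the equation for the chaos pairing with `ℰ_h`. -/
lemma eq_tsum_of_propagatorDefect_eq_zero {L : X →L[ℝ] Y} {N : U →L[ℝ] X →L[ℝ] Y}
    (e : HilbertBasis ι ℝ U) {g : MultiIndex ι → Y} {u : MultiIndex ι → X}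
    (hd : ∀ α, propagatorDefect L N e g u α = 0) (h : U)
    (hu : Summable fun α => |expCoeff (fun k => ⟪e k, h⟫_ℝ) α| * ‖u α‖)
    (hg : Summable fun α => |expCoeff (fun k => ⟪e k, h⟫_ℝ) α| * ‖g α‖) :
    L (∑' α, expCoeff (fun k => ⟪e k, h⟫_ℝ) α • u α) =
      (∑' α, expCoeff (fun k => ⟪e k, h⟫_ℝ) α • g α) +
        N h (∑' α, expCoeff (fun k => ⟪e k, h⟫_ℝ) α • u α) := by
  set s : ι → ℝ := fun k => ⟪e k, h⟫_ℝ with hs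
  -- the equation holds for the finite partial sums of the expansion of `h`, which tend to `h`
  have hF : ∀ F : Finset ι, L (∑' α, expCoeff (Set.indicator (F : Set ι) s) α • u α) =
      (∑' α, expCoeff (Set.indicator (F : Set ι) s) α • g α) +
        N (∑ k ∈ F, s k • e k) (∑' α, expCoeff (Set.indicator (F : Set ι) s) α • u α) := by
    intro F
    have h1 := hasSum_expCoeff_propagatorDefect (L := L) (N := N) (e := e) (F := F)
      (fun k hk => Set.indicator_of_notMem (by simpa using hk) s)
      (summable_expCoeff_indicator_smul F hu).hasSum
      (summable_expCoeff_indicator_smul F hg).hasSum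
    simp only [hd, smul_zero] at h1
    have h2 := h1.unique hasSum_zero
    rw [sub_sub, sub_eq_zero] at h2
    rw [h2]
    congr 3
    refine Finset.sum_congr rfl fun k hk => ?_
    rw [Set.indicator_of_mem (Finset.mem_coe.mpr hk)]
  have hh : Tendsto (fun F : Finset ι => ∑ k ∈ F, s k • e k) atTop (𝓝 h) := by
    have := e.hasSum_repr h
    simp only [e.repr_apply_apply] at this
    exact this
  have tu := tendsto_tsum_expCoeff_indicator hu
  have tg := tendsto_tsum_expCoeff_indicator hg
  have hl := (L.continuous.tendsto _).comp tu
  have hr := tg.add ((N.continuous₂.tendsto _).comp (hh.prodMk_nhds tu))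
  exact tendsto_nhds_unique (hl.congr hF) hr

end

/-! ### The equations as identities in `L²((0,T);V')` -/

section

variable {V H V' U ι Ω : Type*}
  [NormedAddCommGroup V] [InnerProductSpace ℝ V] [CompleteSpace V]
  [NormedAddCommGroup H] [InnerProductSpace ℝ H]
  [NormedAddCommGroup V'] [InnerProductSpace ℝ V']
  [NormedAddCommGroup U] [InnerProductSpace ℝ U]

namespace NormalTriple

/-- The Riesz representative in `V` of an element of `V'`, viewed as a functional on `V`. -/
noncomputable def riesz (tr : NormalTriple V H V') : V' →L[ℝ] V where
  toFun w := (InnerProductSpace.toDual ℝ V).symm (tr.duality w)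
  map_add' w z := by simp
  map_smul' c w := by simp
  cont := (InnerProductSpace.toDual ℝ V).symm.continuous.comp tr.duality.continuous

lemma riesz_embHV' [CompleteSpace H] (tr : NormalTriple V H V') (x : H) :
    tr.riesz (tr.embHV' x) = tr.embVH.adjoint x := by
  refine ext_inner_right ℝ fun v => ?_
  rw [ContinuousLinearMap.adjoint_inner_left, ← tr.duality_eq_inner]
  exact InnerProductSpace.toDual_symm_apply

variable [CompleteSpace V']

/-- The Lions–Magenes lemma for a normal triple. -/
lemma isContinuousInH_of_eq_integral [CompleteSpace H] (tr : NormalTriple V H V') {T : ℝ}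
    (x : TimeL2 T V) (c : H) (g : TimeL2 T V')
    (h : ∀ᵐ t ∂(timeMeasure T),
      tr.embHV' (tr.embVH (x t)) = tr.embHV' c + ∫ s in (0 : ℝ)..t, g s) :
    IsContinuousInH tr T x := by
  refine exists_continuousOn_of_adjoint_eq_integral tr.injVH tr.denseVH (Lp.memLp x)
    (g := fun s => tr.riesz (g s)) (tr.riesz.comp_memLp' (Lp.memLp g)) (c := c) ?_
  filter_upwards [h, ae_mem_Icc_timeMeasure T] with t ht htT
  have hg := (integrable_timeL2 g).intervalIntegrable_of_timeMeasure htT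
  rw [tr.riesz.intervalIntegral_comp_comm hg, ← tr.riesz_embHV', ← tr.riesz_embHV', ← map_add, ht]

end NormalTriple

variable [CompleteSpace V']

section Operators

variable {T : ℝ}

/-- The operator `x ↦ x - ∫ A x ds` from `L²((0,T);V)` to `L²((0,T);V')`. -/
noncomputable def driftOperator (tr : NormalTriple V H V') (A : ℝ → V →L[ℝ] V')
    (hA : ∀ v : TimeL2 T V, MemLp (fun t => A t (v t)) 2 (timeMeasure T)) :
    TimeL2 T V →L[ℝ] TimeL2 T V' :=
  (tr.embHV'.comp tr.embVH).compLpL 2 (timeMeasure T) - (volterra T).comp (familyLp A hA)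

/-- The operator `(h, x) ↦ ∫ (M x, h)_U ds`. -/
noncomputable def noiseOperator (M : ℝ → V →L[ℝ] HilbertTensor V' U)
    (hM : ∀ v : TimeL2 T V, MemLp (fun t => M t (v t)) 2 (timeMeasure T)) :
    U →L[ℝ] TimeL2 T V →L[ℝ] TimeL2 T V' :=
  ((ContinuousLinearMap.compL ℝ (TimeL2 T V) (TimeL2 T V') (TimeL2 T V') (volterra T)).comp
    ((ContinuousLinearMap.compL ℝ (TimeL2 T V) (TimeL2 T (HilbertTensor V' U))
      (TimeL2 T V')).flip (familyLp M hM))).comp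
    ((innerUL V' U).compLpL₂ 2 (timeMeasure T))

lemma noiseOperator_apply (M : ℝ → V →L[ℝ] HilbertTensor V' U)
    (hM : ∀ v : TimeL2 T V, MemLp (fun t => M t (v t)) 2 (timeMeasure T)) (h : U)
    (x : TimeL2 T V) :
    noiseOperator M hM h x = volterra T ((innerUL V' U h).compLp (familyLp M hM x)) := rfl

lemma coeFn_compLp_familyLp (M : ℝ → V →L[ℝ] HilbertTensor V' U)
    (hM : ∀ v : TimeL2 T V, MemLp (fun t => M t (v t)) 2 (timeMeasure T)) (h : U)
    (x : TimeL2 T V) : (innerUL V' U h).compLp (familyLp M hM x) =ᵐ[timeMeasure T]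
      fun t => innerU h (M t (x t)) := by
  filter_upwards [(innerUL V' U h).coeFn_compLp (familyLp M hM x), coeFn_familyLp M hM x]
    with t h1 h2
  rw [h1, h2, innerUL_apply]

/-- The operator `(c, φ) ↦ c + ∫ φ ds` that is applied to the initial value and the free term. -/
noncomputable def dataOperator (tr : NormalTriple V H V') (T : ℝ) (c : H) (φ : TimeL2 T V') :
    TimeL2 T V' :=
  ((Lp.constL 2 (timeMeasure T) ℝ).comp tr.embHV') c + volterra T φ

lemma coeFn_drift_add (A : ℝ → V →L[ℝ] V')
    (hA : ∀ v : TimeL2 T V, MemLp (fun t => A t (v t)) 2 (timeMeasure T)) (x : TimeL2 T V)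
    (φ z : TimeL2 T V') {ζ : ℝ → V'} (hz : z =ᵐ[timeMeasure T] ζ) :
    (familyLp A hA x + φ + z : TimeL2 T V') =ᵐ[timeMeasure T]
      fun s => A s (x s) + φ s + ζ s := by
  filter_upwards [Lp.coeFn_add (familyLp A hA x + φ) z, Lp.coeFn_add (familyLp A hA x) φ,
    coeFn_familyLp A hA x, hz] with t h1 h2 h3 h4
  rw [h1, Pi.add_apply, h2, Pi.add_apply, h3, h4]

/-- The integral equation as an identity in `L²((0,T);V')`. -/
lemma ae_eq_iff_driftOperator_eq (tr : NormalTriple V H V') (A : ℝ → V →L[ℝ] V')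
    (hA : ∀ v : TimeL2 T V, MemLp (fun t => A t (v t)) 2 (timeMeasure T)) (x : TimeL2 T V)
    (c : H) (φ z : TimeL2 T V') {ζ : ℝ → V'} (hz : z =ᵐ[timeMeasure T] ζ) :
    (∀ᵐ t ∂(timeMeasure T), tr.embHV' (tr.embVH (x t)) =
      tr.embHV' c + ∫ s in (0 : ℝ)..t, (A s (x s) + φ s + ζ s)) ↔
    driftOperator tr A hA x = dataOperator tr T c φ + volterra T z := by
  refine (ae_eq_add_integral_iff (tr.embHV'.comp tr.embVH) x (tr.embHV' c)
    (familyLp A hA x + φ + z) (coeFn_drift_add A hA x φ z hz)).trans ?_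
  rw [map_add, map_add, driftOperator, dataOperator]
  simp only [sub_apply, ContinuousLinearMap.comp_apply]
  rw [sub_eq_iff_eq_add]
  constructor
  all_goals
    intro h
    rw [h]
    abel

lemma coeFn_propagatorSum (e : ι → U) (M : ℝ → V →L[ℝ] HilbertTensor V' U)
    (hM : ∀ v : TimeL2 T V, MemLp (fun t => M t (v t)) 2 (timeMeasure T))
    (u : MultiIndex ι → TimeL2 T V) (α : MultiIndex ι) :
    (α.sum fun k n => √(n : ℝ) •
        (innerUL V' U (e k)).compLp (familyLp M hM (u (α - Finsupp.single k 1))) : TimeL2 T V')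
      =ᵐ[timeMeasure T] fun s => α.sum fun k n =>
        √(n : ℝ) • innerU (e k) (M s (u (α - Finsupp.single k 1) s)) := by
  simp only [Finsupp.sum]
  refine (Lp.coeFn_fun_finsetSum _ _).trans ?_
  have h1 : ∀ᵐ t ∂(timeMeasure T), ∀ k ∈ α.support,
      (√(α k : ℝ) • (innerUL V' U (e k)).compLp (familyLp M hM (u (α - Finsupp.single k 1))) :
        TimeL2 T V') t = √(α k : ℝ) • innerU (e k) (M t (u (α - Finsupp.single k 1) t)) := by
    refine (Filter.eventually_all_finset _).mpr fun k _ => ?_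
    filter_upwards [coeFn_compLp_familyLp M hM (e k) (u (α - Finsupp.single k 1)),
      Lp.coeFn_smul (√(α k : ℝ))
        ((innerUL V' U (e k)).compLp (familyLp M hM (u (α - Finsupp.single k 1))))] with t h2 h3
    rw [h3, Pi.smul_apply, h2]
  filter_upwards [h1] with t ht
  exact Finset.sum_congr rfl ht

lemma propagatorEq_iff_propagatorDefect_eq_zero (tr : NormalTriple V H V')
    (e : HilbertBasis ι ℝ U) (A : ℝ → V →L[ℝ] V')
    (hA : ∀ v : TimeL2 T V, MemLp (fun t => A t (v t)) 2 (timeMeasure T))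
    (M : ℝ → V →L[ℝ] HilbertTensor V' U)
    (hM : ∀ v : TimeL2 T V, MemLp (fun t => M t (v t)) 2 (timeMeasure T))
    (u₀ : MultiIndex ι → H) (f : MultiIndex ι → TimeL2 T V') (u : MultiIndex ι → TimeL2 T V)
    (α : MultiIndex ι) :
    PropagatorEq tr T e A M u₀ f u α ↔ propagatorDefect (driftOperator tr A hA)
      (noiseOperator M hM) e (fun α => dataOperator tr T (u₀ α) (f α)) u α = 0 := by
  refine (ae_eq_iff_driftOperator_eq tr A hA (u α) (u₀ α) (f α) _
    (coeFn_propagatorSum e M hM u α)).trans ?_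
  rw [propagatorDefect, sub_sub, sub_eq_zero]
  simp only [Finsupp.sum, map_sum, map_smul, noiseOperator_apply]

lemma isContinuousInH_of_propagatorEq [CompleteSpace H] (tr : NormalTriple V H V')
    (e : HilbertBasis ι ℝ U) (A : ℝ → V →L[ℝ] V')
    (hA : ∀ v : TimeL2 T V, MemLp (fun t => A t (v t)) 2 (timeMeasure T))
    (M : ℝ → V →L[ℝ] HilbertTensor V' U)
    (hM : ∀ v : TimeL2 T V, MemLp (fun t => M t (v t)) 2 (timeMeasure T))
    (u₀ : MultiIndex ι → H) (f : MultiIndex ι → TimeL2 T V') (u : MultiIndex ι → TimeL2 T V)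
    (α : MultiIndex ι) (h : PropagatorEq tr T e A M u₀ f u α) : IsContinuousInH tr T (u α) := by
  refine tr.isContinuousInH_of_eq_integral (u α) (u₀ α) (familyLp A hA (u α) + f α +
    α.sum fun k n => √(n : ℝ) •
      (innerUL V' U (e k)).compLp (familyLp M hM (u (α - Finsupp.single k 1)))) ?_
  filter_upwards [h, ae_mem_Icc_timeMeasure T] with t ht htT
  rw [ht, intervalIntegral_congr_timeMeasure htT
    (coeFn_drift_add A hA (u α) (f α) _ (coeFn_propagatorSum e M hM u α))]

/-- The equation for the pairing with `ℰ_h` as an identity in `L²((0,T);V')`. -/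
lemma ae_eq_iff_driftOperator_eq_noiseOperator (tr : NormalTriple V H V') (A : ℝ → V →L[ℝ] V')
    (hA : ∀ v : TimeL2 T V, MemLp (fun t => A t (v t)) 2 (timeMeasure T))
    (M : ℝ → V →L[ℝ] HilbertTensor V' U)
    (hM : ∀ v : TimeL2 T V, MemLp (fun t => M t (v t)) 2 (timeMeasure T))
    (x : TimeL2 T V) (c : H) (φ : TimeL2 T V') (h : U) :
    (∀ᵐ t ∂(timeMeasure T), tr.embHV' (tr.embVH (x t)) =
      tr.embHV' c + ∫ s in (0 : ℝ)..t, (A s (x s) + φ s + innerU h (M s (x s)))) ↔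
    driftOperator tr A hA x = dataOperator tr T c φ + noiseOperator M hM h x :=
  ae_eq_iff_driftOperator_eq tr A hA x c φ _ (coeFn_compLp_familyLp M hM h x)

lemma hasSum_dataOperator (tr : NormalTriple V H V') {c : ι → ℝ} {u₀ : ι → H}
    {f : ι → TimeL2 T V'} {x₀ : H} {φ : TimeL2 T V'} (h₀ : HasSum (fun α => c α • u₀ α) x₀)
    (hf : HasSum (fun α => c α • f α) φ) :
    HasSum (fun α => c α • dataOperator tr T (u₀ α) (f α)) (dataOperator tr T x₀ φ) := by
  have h := (h₀.mapL ((Lp.constL 2 (timeMeasure T) ℝ).comp tr.embHV')).add (hf.mapL (volterra T))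
  simp only [map_smul, ← smul_add] at h
  exact h

lemma summable_mul_norm_dataOperator (tr : NormalTriple V H V') {c : ι → ℝ} {u₀ : ι → H}
    {f : ι → TimeL2 T V'} (h₀ : Summable fun α => |c α| * ‖u₀ α‖)
    (hf : Summable fun α => |c α| * ‖f α‖) :
    Summable fun α => |c α| * ‖dataOperator tr T (u₀ α) (f α)‖ := by
  set K := (Lp.constL 2 (timeMeasure T) ℝ).comp tr.embHV'
  refine ((h₀.mul_left ‖K‖).add (hf.mul_left ‖volterra (X := V') T‖)).of_nonneg_of_le
    (fun _ => by positivity) fun α => ?_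
  have h1 : ‖dataOperator tr T (u₀ α) (f α)‖ ≤
      ‖K‖ * ‖u₀ α‖ + ‖volterra (X := V') T‖ * ‖f α‖ :=
    (norm_add_le (K (u₀ α)) (volterra T (f α))).trans (add_le_add (K.le_opNorm (u₀ α))
      ((volterra (X := V') T).le_opNorm (f α)))
  calc |c α| * ‖dataOperator tr T (u₀ α) (f α)‖
      ≤ |c α| * (‖K‖ * ‖u₀ α‖ + ‖volterra (X := V') T‖ * ‖f α‖) :=
        mul_le_mul_of_nonneg_left h1 (abs_nonneg _)
    _ = _ := by ring

end Operators

section Pairing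

variable [MeasurableSpace Ω] {P : Measure Ω} [IsProbabilityMeasure P] {W : U → Ω → ℝ}
  {X : Type*} [NormedAddCommGroup X]

lemma chaosPairing_stochExp [NormedSpace ℝ X] (hW : IsGaussianNoise P W) (e : HilbertBasis ι ℝ U)
    (η : MultiIndex ι → X) (h : U) :
    chaosPairing P W e η (stochExp W h) = ∑' α, expCoeff (fun k => ⟪e k, h⟫_ℝ) α • η α := by
  simp only [chaosPairing, integral_stochExp_mul_chaosBasis hW]

lemma summable_abs_expCoeff_mul_norm (hW : IsGaussianNoise P W) (e : HilbertBasis ι ℝ U)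
    {q : ι → ℝ} (hq : IsWeight q) {r : ℝ} {η : MultiIndex ι → X} {h : U} (hη : MemChaos q r η)
    (hh : MemChaosDual P W e q r (stochExp W h)) :
    Summable fun α => |expCoeff (fun k => ⟪e k, h⟫_ℝ) α| * ‖η α‖ :=
  Summable.abs_mul_norm_of_weighted (chaosWeight_pos hq r)
    ((memChaosDual_stochExp_iff hW e hq r h).mp hh) hη

/-- Small combinations of finitely many basis vectors are admissible test directions. -/
lemma exists_pos_forall_memChaosDual (hW : IsGaussianNoise P W) (e : HilbertBasis ι ℝ U)
    {q : ι → ℝ} (hq : IsWeight q) (r : ℝ) (F : Finset ι) :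
    ∃ δ > 0, ∀ s : ι → ℝ, (∀ k ∈ F, |s k| ≤ δ) →
      MemChaosDual P W e q r (stochExp W (∑ k ∈ F, s k • e k)) := by
  classical
  obtain ⟨δ, hδ, h⟩ := exists_pos_forall_sum_sq_mul_lt_one F fun k => (q k ^ (2 * r))⁻¹
  refine ⟨δ, hδ, fun s hs => ?_⟩
  rw [memChaosDual_stochExp_iff hW e hq]
  refine summable_expCoeff_sq_div_chaosWeight (F := F) hq r
    (fun k hk => by rw [inner_sum_smul_hilbertBasis, if_neg hk]) ?_
  refine lt_of_eq_of_lt (Finset.sum_congr rfl fun k hk => ?_) (h s hs)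
  rw [inner_sum_smul_hilbertBasis, if_pos hk]

end Pairing

end

theorem theorem4p1
    {V H V' U ι Ω : Type*}
    [NormedAddCommGroup V] [InnerProductSpace ℝ V] [CompleteSpace V]
    [NormedAddCommGroup H] [InnerProductSpace ℝ H] [CompleteSpace H]
    [NormedAddCommGroup V'] [InnerProductSpace ℝ V'] [CompleteSpace V']
    [NormedAddCommGroup U] [InnerProductSpace ℝ U] [CompleteSpace U] [Countable ι]
    [MeasurableSpace Ω] (P : Measure Ω) [IsProbabilityMeasure P]
    (W : U → Ω → ℝ) (hW : IsGaussianNoise P W) (e : HilbertBasis ι ℝ U)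
    (tr : NormalTriple V H V') (T : ℝ) (hT : 0 < T)
    (A : ℝ → V →L[ℝ] V') (M : ℝ → V →L[ℝ] HilbertTensor V' U)
    (hA : ∀ v : TimeL2 T V, MemLp (fun t => A t (v t)) 2 (timeMeasure T))
    (hM : ∀ v : TimeL2 T V, MemLp (fun t => M t (v t)) 2 (timeMeasure T))
    (q : ι → ℝ) (hq : IsWeight q)
    (u₀ : MultiIndex ι → H) (hu₀ : ∃ r, MemChaos q r u₀)
    (f : MultiIndex ι → TimeL2 T V') (hf : ∃ r, MemChaos q r f)
    (q' : ι → ℝ) (hq' : IsWeight q') (r' : ℝ)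
    (u : MultiIndex ι → TimeL2 T V) (hu : MemChaos q' r' u) :
    IsChaosSolution tr T P W e A M q u₀ f q' r' u ↔
      (∀ α, IsContinuousInH tr T (u α)) ∧ (∀ α, PropagatorEq tr T e A M u₀ f u α) := by
  classical
  constructor
  · rintro ⟨-, hsol⟩
    have hprop : ∀ α, PropagatorEq tr T e A M u₀ f u α := by
      intro α
      rw [propagatorEq_iff_propagatorDefect_eq_zero tr e A hA M hM]
      obtain ⟨r₀, hr₀⟩ := hu₀
      obtain ⟨r₁, hr₁⟩ := hf
      set F := α.support
      obtain ⟨δ₁, hδ₁, h₁⟩ := exists_pos_forall_sum_sq_mul_lt_one F fun k => q' k ^ 2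
      obtain ⟨δ₂, hδ₂, h₂⟩ := exists_pos_forall_memChaosDual hW e hq' r' F
      obtain ⟨δ₃, hδ₃, h₃⟩ := exists_pos_forall_memChaosDual hW e hq r₀ F
      obtain ⟨δ₄, hδ₄, h₄⟩ := exists_pos_forall_memChaosDual hW e hq r₁ F
      refine eq_zero_of_hasSum_expCoeff_smul (F := F)
        (δ := min (min δ₁ δ₂) (min δ₃ δ₄)) (by positivity) (fun s hs hs' => ?_) subset_rfl
      have hs₁ : ∀ k ∈ F, |s k| ≤ δ₁ := fun k _ =>
        (hs' k).trans ((min_le_left _ _).trans (min_le_left _ _))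
      have hs₂ : ∀ k ∈ F, |s k| ≤ δ₂ := fun k _ =>
        (hs' k).trans ((min_le_left _ _).trans (min_le_right _ _))
      have hs₃ : ∀ k ∈ F, |s k| ≤ δ₃ := fun k _ =>
        (hs' k).trans ((min_le_right _ _).trans (min_le_left _ _))
      have hs₄ : ∀ k ∈ F, |s k| ≤ δ₄ := fun k _ =>
        (hs' k).trans ((min_le_right _ _).trans (min_le_right _ _))
      have heq := hsol (∑ k ∈ F, s k • e k) (sufficientlySmall_sum_smul e (h₁ s hs₁)) (h₂ s hs₂)
        ⟨r₀, hr₀, h₃ s hs₃⟩ ⟨r₁, hr₁, h₄ s hs₄⟩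
      have hcoef : (fun k => ⟪e k, ∑ j ∈ F, s j • e j⟫_ℝ) = s := by
        funext k
        rw [inner_sum_smul_hilbertBasis]
        split_ifs with hk
        · rfl
        · exact (hs k hk).symm
      have su := summable_abs_expCoeff_mul_norm hW e hq' hu (h₂ s hs₂)
      have s₀ := summable_abs_expCoeff_mul_norm hW e hq hr₀ (h₃ s hs₃)
      have s₁ := summable_abs_expCoeff_mul_norm hW e hq hr₁ (h₄ s hs₄)
      have heq' := (ae_eq_iff_driftOperator_eq_noiseOperator tr A hA M hM _ _ _ _).mp heq
      rw [chaosPairing_stochExp hW, chaosPairing_stochExp hW, chaosPairing_stochExp hW] at heq'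
      rw [hcoef] at heq' su s₀ s₁
      have hsum := hasSum_expCoeff_propagatorDefect (L := driftOperator tr A hA)
        (N := noiseOperator M hM) (e := e) hs (summable_expCoeff_smul su).hasSum
        (hasSum_dataOperator tr (summable_expCoeff_smul s₀).hasSum
          (summable_expCoeff_smul s₁).hasSum)
      rwa [heq', add_sub_cancel_left, sub_self] at hsum
    exact ⟨fun α => isContinuousInH_of_propagatorEq tr e A hA M hM u₀ f u α (hprop α), hprop⟩
  · rintro ⟨-, hprop⟩
    refine ⟨hu, ?_⟩
    rintro h - hh ⟨r₀, hr₀, hh₀⟩ ⟨r₁, hr₁, hh₁⟩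
    refine (ae_eq_iff_driftOperator_eq_noiseOperator tr A hA M hM _ _ _ _).mpr ?_
    have su := summable_abs_expCoeff_mul_norm hW e hq' hu hh
    have s₀ := summable_abs_expCoeff_mul_norm hW e hq hr₀ hh₀
    have s₁ := summable_abs_expCoeff_mul_norm hW e hq hr₁ hh₁
    rw [chaosPairing_stochExp hW, chaosPairing_stochExp hW, chaosPairing_stochExp hW]
    rw [eq_tsum_of_propagatorDefect_eq_zero e (fun α =>
      (propagatorEq_iff_propagatorDefect_eq_zero tr e A hA M hM u₀ f u α).mp (hprop α)) h su
      (summable_mul_norm_dataOperator tr s₀ s₁)]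
    rw [(hasSum_dataOperator tr (summable_expCoeff_smul s₀).hasSum
      (summable_expCoeff_smul s₁).hasSum).tsum_eq]
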